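/- **Setting.** Let $n\in\{2,3\}$, let $m\ge 1$ and $k\in\{m-1,m\}$ be integers, and let $\nu>0$, $\alpha>0$, $r\ge 2$ be real. Let $K\subset\mathbb R^n$ be a closed nondegenerate simplex (an element of the mesh), with diameter $h_K$ and outward unit normal $\boldsymbol n$, and let $\boldsymbol f\in[L^2(K)]^n$. $P_j(K)$ and $P_j(e)$ denote the polynomials of degree at most $j$ on $K$ and on a face $e$ of $K$; $(\cdot,\cdot)_K$ and $\langle\cdot,\cdot\rangle_{\partial K}$ are the $L^2$ products; $\Pi_k^B$ is, on each face $e\subset\partial K$, the $L^2(e)$-orthogonal projection onto $P_k(e)$, applied componentwise to vectors; $\eta:=h_K^{-1}$; and $\boldsymbol u\otimes\boldsymbol v:=(u_iv_j)_{i,j}$. For an integer $\gamma\ge0$, the weak gradient $\nabla_{w,\gamma}\{v_i,v_b\}\in[P_\gamma(K)]^n$ and the weak divergence $\nabla_{w,\gamma}\cdot\{\boldsymbol w_i,\boldsymbol w_b\}\in P_\gamma(K)$ are defined by $$(\nabla_{w,\gamma}\{v_i,v_b\},\boldsymbol\varsigma)_K=-(v_i,\nabla\cdot\boldsymbol\varsigma)_K+\langle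 v_b,\boldsymbol\varsigma\cdot\boldsymbol n\rangle_{\partial K}\quad\forall\boldsymbol\varsigma\in[P_\gamma(K)]^n,$$ $$(\nabla_{w,\gamma}\cdot\{\boldsymbol w_i,\boldsymbol w_b\},\varsigma)_K=-(\boldsymbol w_i,\nabla\varsigma)_K+\langle\boldsymbol w_b\cdot\boldsymbol n,\varsigma\rangle_{\partial K}\quad\forall\varsigma\in P_\gamma(K),$$ and are taken componentwise for vectors, respectively row by row for matrices. Let numerical traces $\boldsymbol u_{hb}$ and $p_{hb}$ on $\partial K$ be given with $\boldsymbol u_{hb}|_e\in[P_k(e)]^n$ and $p_{hb}|_e\in P_m(e)$ for each face $e$ of $K$. For $\boldsymbol\kappa,\boldsymbol u,\boldsymbol v\in[P_m(K)]^n$ and $q\in P_{m-1}(K)$ put $$\begin{aligned} a_{h,K}(\boldsymbol u,\boldsymbol v)&:=\nu(\nabla_{w,m-1}\{\boldsymbol u,\boldsymbol 0\},\nabla_{w,m-1}\{\boldsymbol v,\boldsymbol 0\})_K+\nu\langle\eta\,\Pi_k^B\boldsymbol u,\Pi_k^B\boldsymbol v\rangle_{\partial K},\\ b_{h,K}(\boldsymbol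 v,q)&:=(\nabla_{w,m}\{q,0\},\boldsymbol v)_K,\qquad c_{h,K}(\boldsymbol\kappa;\boldsymbol u,\boldsymbol v):=(\alpha|\boldsymbol\kappa|^{r-2}\boldsymbol u,\boldsymbol v)_K,\\ d_{h,K}(\boldsymbol\kappa;\boldsymbol u,\boldsymbol v)&:=\tfrac12(\nabla_{w,m}\cdot\{\boldsymbol u\otimes\boldsymbol\kappa,\boldsymbol 0\},\boldsymbol v)_K-\tfrac12(\nabla_{w,m}\cdot\{\boldsymbol v\otimes\boldsymbol\kappa,\boldsymbol 0\},\boldsymbol u)_K,\\ F_{h,K}(\boldsymbol v)&:=(\boldsymbol f,\boldsymbol v)_K-\nu(\nabla_{w,m-1}\{\boldsymbol 0,\boldsymbol u_{hb}\},\nabla_{w,m-1}\{\boldsymbol v,\boldsymbol 0\})_K+\nu\langle\eta\,\boldsymbol u_{hb},\Pi_k^B\boldsymbol v\rangle_{\partial K}\\ &\qquad-\tfrac12(\nabla_{w,m}\cdot\{\boldsymbol 0,\boldsymbol u_{hb}\otimes\boldsymbol u_{hb}\},\boldsymbol v)_K-(\nabla_{w,m}\{0,p_{hb}\},\boldsymbol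 v)_K . \end{aligned}$$ The *local problem* is: find $(\boldsymbol u_{hi},p_{hi})\in[P_m(K)]^n\times P_{m-1}(K)$ such that $$\begin{aligned} a_{h,K}(\boldsymbol u_{hi},\boldsymbol v)+b_{h,K}(\boldsymbol v,p_{hi})+c_{h,K}(\boldsymbol u_{hi};\boldsymbol u_{hi},\boldsymbol v)+d_{h,K}(\boldsymbol u_{hi};\boldsymbol u_{hi},\boldsymbol v)&=F_{h,K}(\boldsymbol v)&&\forall\boldsymbol v\in[P_m(K)]^n,\\ b_{h,K}(\boldsymbol u_{hi},q)&=0&&\forall q\in P_{m-1}(K). \end{aligned}$$ Let $\boldsymbol V_{0h,K}:=\{\boldsymbol\kappa\in[P_m(K)]^n: b_{h,K}(\boldsymbol\kappa,q)=0\ \ \forall q\in P_{m-1}(K)\}$, $|||\boldsymbol v|||_{V,K}:=\big(\|\nabla_{w,m-1}\{\boldsymbol v,\boldsymbol 0\}\|_{0,K}^2+\|\eta^{1/2}\Pi_k^B\boldsymbol v\|_{0,\partial K}^2\big)^{1/2}$, and $$\mathcal N_{h,K}:=\sup_{\boldsymbol 0\ne\boldsymbol\kappa,\boldsymbol u,\boldsymbol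 v\in\boldsymbol V_{0h,K}}\frac{d_{h,K}(\boldsymbol\kappa;\boldsymbol u,\boldsymbol v)}{|||\boldsymbol\kappa|||_{V,K}\,|||\boldsymbol u|||_{V,K}\,|||\boldsymbol v|||_{V,K}},\qquad \|F_{h,K}\|_{*,h}:=\sup_{\boldsymbol 0\ne\boldsymbol v\in\boldsymbol V_{0h,K}}\frac{F_{h,K}(\boldsymbol v)}{|||\boldsymbol v|||_{V,K}} .$$ **Theorem.** For every such $K$ and all given traces $\boldsymbol u_{hb},p_{hb}$, the local problem has at least one solution $(\boldsymbol u_{hi},p_{hi})$. Moreover $\mathcal N_{h,K}$ and $\|F_{h,K}\|_{*,h}$ are finite, and if $$\frac{\mathcal N_{h,K}\,\|F_{h,K}\|_{*,h}}{\nu^2}<1,$$ then the local problem has exactly one solution. -/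

import Mathlib

namespace WG

noncomputable section

open MeasureTheory

/-! ### Polynomials -/

/-- Real polynomials in `n` variables. -/
abbrev Poly (n : ℕ) : Type := MvPolynomial (Fin n) ℝ

/-- `P_j`: polynomials of total degree at most `j`. -/
abbrev P (n j : ℕ) : Submodule ℝ (Poly n) := MvPolynomial.restrictTotalDegree (Fin n) ℝ j

/-- `[P_j]^n`: vector fields all of whose components are polynomials of degree at most `j`. -/
def VecP (n j : ℕ) : Submodule ℝ (Fin n → Poly n) := Submodule.pi Set.univ fun _ => P n j

/-- Value of a polynomial at a point of `ℝⁿ`. -/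
def val {n : ℕ} (p : Poly n) (x : EuclideanSpace ℝ (Fin n)) : ℝ :=
  MvPolynomial.eval (fun i => x i) p

/-- Value of a polynomial vector field, as a vector of Euclidean space. -/
def vecVal {n : ℕ} (v : Fin n → Poly n) (x : EuclideanSpace ℝ (Fin n)) :
    EuclideanSpace ℝ (Fin n) :=
  WithLp.toLp 2 fun j => val (v j) x

/-- Divergence of a polynomial vector field. -/
def div {n : ℕ} (v : Fin n → Poly n) : Poly n := ∑ j, MvPolynomial.pderiv j (v j)

lemma val_add {n : ℕ} (p q : Poly n) (x : EuclideanSpace ℝ (Fin n)) :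
    val (p + q) x = val p x + val q x := by simp [val]

lemma val_smul {n : ℕ} (c : ℝ) (p : Poly n) (x : EuclideanSpace ℝ (Fin n)) :
    val (c • p) x = c * val p x := by simp [val]

lemma continuous_val {n : ℕ} (p : Poly n) : Continuous (val p) := by
  unfold val
  exact (MvPolynomial.continuous_eval p).comp (by fun_prop)

/-! ### Elements, faces, normals, surface measure -/

/-- The nondegenerate `n`-simplices of `ℝⁿ`, given by `n + 1` affinely independent vertices; the
closed simplex itself is the set `K.closedInterior`. -/
abbrev Element (n : ℕ) : Type := Affine.Simplex ℝ (EuclideanSpace ℝ (Fin n)) n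

/-- The face of `K` opposite to the vertex `i`. The boundary `∂K` is the union of these. -/
def face {n : ℕ} [NeZero n] (K : Element n) (i : Fin (n + 1)) :
    Set (EuclideanSpace ℝ (Fin n)) :=
  (K.faceOpposite i).closedInterior

/-- Surface measure on a face: the `(n-1)`-dimensional Hausdorff measure, normalised so that it
agrees with Lebesgue measure on Euclidean `(n-1)`-spaces. -/
def faceMeasure {n : ℕ} [NeZero n] (K : Element n) (i : Fin (n + 1)) :
    Measure (EuclideanSpace ℝ (Fin n)) :=
  (Measure.euclideanHausdorffMeasure (n - 1)).restrict (face K i)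

/-- The outward unit normal on the face opposite to the vertex `i`: the unit vector pointing from
this vertex to the foot of the altitude through it. -/
def normal {n : ℕ} [NeZero n] (K : Element n) (i : Fin (n + 1)) : EuclideanSpace ℝ (Fin n) :=
  (K.height i)⁻¹ • (K.altitudeFoot i - K.points i)

/-- The diameter `h_K`. -/
def hK {n : ℕ} (K : Element n) : ℝ := Metric.diam K.closedInterior

lemma isCompact_element {n : ℕ} (K : Element n) : IsCompact K.closedInterior :=
  Affine.Simplex.isCompact_closedInterior K

lemma isCompact_face {n : ℕ} [NeZero n] (K : Element n) (i : Fin (n + 1)) :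
    IsCompact (face K i) :=
  Affine.Simplex.isCompact_closedInterior _

lemma face_measure_lt_top {n : ℕ} [NeZero n] (K : Element n) (i : Fin (n + 1)) :
    Measure.euclideanHausdorffMeasure (n - 1) (face K i) < ⊤ := by
  set F := K.faceOpposite i with hF
  set S : AffineSubspace ℝ (EuclideanSpace ℝ (Fin n)) := affineSpan ℝ (Set.range F.points) with hS
  have hsub : face K i ⊆ (S : Set (EuclideanSpace ℝ (Fin n))) :=
    Affine.Simplex.closedInterior_subset_affineSpan
  have hne : Nonempty S := ⟨⟨F.points 0, subset_affineSpan ℝ _ ⟨0, rfl⟩⟩⟩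
  have hfin : Module.finrank ℝ S.direction = n - 1 := by
    rw [hS, direction_affineSpan]
    exact F.independent.finrank_vectorSpan (by simp)
  set T : Set S := Subtype.val ⁻¹' face K i with hT
  have hST : face K i = Subtype.val '' T := by
    ext x
    constructor
    · exact fun hx => ⟨⟨x, hsub hx⟩, hx, rfl⟩
    · rintro ⟨y, hy, rfl⟩
      exact hy
  have hcl : IsClosed (S : Set (EuclideanSpace ℝ (Fin n))) := S.closed_of_finiteDimensional
  have hTc : IsCompact T :=
    (hcl.isClosedEmbedding_subtypeVal).isCompact_preimage (isCompact_face K i)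
  rw [hST, AffineSubspace.euclideanHausdorffMeasure_coe_image]
  obtain ⟨p⟩ := hne
  rw [← hfin, EuclideanGeometry.euclideanHausdorffMeasure_eq p]
  have hmap := (IsometryEquiv.vaddConst p).toHomeomorph.toMeasurableEquiv.map_apply
    (μ := (volume : Measure S.direction)) T
  refine lt_of_eq_of_lt hmap ?_
  exact ((IsometryEquiv.vaddConst p).toHomeomorph.isCompact_preimage.2 hTc).measure_lt_top

instance {n : ℕ} [NeZero n] (K : Element n) (i : Fin (n + 1)) :
    IsFiniteMeasure (faceMeasure K i) :=
  ⟨by rw [faceMeasure, Measure.restrict_apply_univ]; exact face_measure_lt_top K i⟩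

/-! ### `L²` products on elements and faces -/

/-- `(p, q)_K`. -/
def innerK {n : ℕ} (K : Element n) (p q : Poly n) : ℝ :=
  ∫ x in K.closedInterior, val p x * val q x

/-- `⟨p, q⟩_e` for the face `e` opposite to the vertex `i`. -/
def innerFace {n : ℕ} [NeZero n] (K : Element n) (i : Fin (n + 1)) (p q : Poly n) : ℝ :=
  ∫ x, val p x * val q x ∂(faceMeasure K i)

lemma innerK_comm {n : ℕ} (K : Element n) (p q : Poly n) : innerK K p q = innerK K q p := by
  simp only [innerK, mul_comm]

lemma integrable_K {n : ℕ} (K : Element n) (p q : Poly n) :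
    IntegrableOn (fun x => val p x * val q x) K.closedInterior :=
  ((continuous_val p).mul (continuous_val q)).continuousOn.integrableOn_compact
    (isCompact_element K)

lemma integrable_face {n : ℕ} [NeZero n] (K : Element n) (i : Fin (n + 1)) (p q : Poly n) :
    Integrable (fun x => val p x * val q x) (faceMeasure K i) :=
  ((continuous_val p).mul (continuous_val q)).continuousOn.integrableOn_of_subset_isCompact
    (isCompact_face K i) (isCompact_face K i).measurableSet subset_rfl
    (face_measure_lt_top K i).ne

lemma innerK_add_right {n : ℕ} (K : Element n) (p q q' : Poly n) :
    innerK K p (q + q') = innerK K p q + innerK K p q' := by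
  simp only [innerK, val_add, mul_add]
  exact integral_add (integrable_K K p q) (integrable_K K p q')

lemma innerK_smul_right {n : ℕ} (K : Element n) (c : ℝ) (p q : Poly n) :
    innerK K p (c • q) = c * innerK K p q := by
  simp only [innerK, val_smul, mul_left_comm, integral_const_mul]

lemma innerFace_add_right {n : ℕ} [NeZero n] (K : Element n) (i : Fin (n + 1))
    (p q q' : Poly n) : innerFace K i p (q + q') = innerFace K i p q + innerFace K i p q' := by
  simp only [innerFace, val_add, mul_add]
  exact integral_add (integrable_face K i p q) (integrable_face K i p q')

lemma innerFace_smul_right {n : ℕ} [NeZero n] (K : Element n) (i : Fin (n + 1)) (c : ℝ)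
    (p q : Poly n) : innerFace K i p (c • q) = c * innerFace K i p q := by
  simp only [innerFace, val_smul, mul_left_comm, integral_const_mul]

lemma interior_element_nonempty {n : ℕ} (K : Element n) :
    (interior K.closedInterior).Nonempty := by
  rw [← Affine.Simplex.convexHull_eq_closedInterior,
    interior_convexHull_nonempty_iff_affineSpan_eq_top]
  exact (K.independent.affineSpan_eq_top_iff_card_eq_finrank_add_one).2 (by simp)

lemma eq_zero_of_innerK_self {n : ℕ} (K : Element n) (p : Poly n) (h : innerK K p p = 0) :
    p = 0 := by
  have h0 : ∀ x ∈ interior K.closedInterior, val p x = 0 := by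
    have hae : (fun x => val p x * val p x) =ᵐ[volume.restrict K.closedInterior] 0 :=
      (integral_eq_zero_iff_of_nonneg (fun x => mul_self_nonneg _) (integrable_K K p p)).1 h
    have hae' : (fun x => val p x * val p x) =ᵐ[volume.restrict (interior K.closedInterior)] 0 :=
      hae.filter_mono (ae_mono (Measure.restrict_mono interior_subset le_rfl))
    have := Measure.eqOn_open_of_ae_eq hae' isOpen_interior
      ((continuous_val p).mul (continuous_val p)).continuousOn continuousOn_const
    intro x hx
    exact mul_self_eq_zero.1 (this hx)
  obtain ⟨x, hx⟩ := interior_element_nonempty K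
  have hU : IsOpen ((WithLp.toLp 2 : (Fin n → ℝ) → EuclideanSpace ℝ (Fin n)) ⁻¹'
      interior K.closedInterior) :=
    isOpen_interior.preimage (PiLp.continuous_toLp 2 _)
  obtain ⟨ε, hε, hball⟩ := Metric.isOpen_iff.1 hU x.ofLp (by simpa using hx)
  refine MvPolynomial.funext_set (fun i => Metric.ball (x i) ε)
    (fun i => ?_) fun y hy => ?_
  · rw [Real.ball_eq_Ioo]
    exact Set.Ioo_infinite (by linarith)
  · have hy' : y ∈ Metric.ball x.ofLp ε := by
      rw [ball_pi _ hε]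
      exact hy
    simpa [val] using h0 _ (hball hy')

/-- Riesz representation in `P_γ(K)`. -/
lemma exists_riesz {n : ℕ} (K : Element n) (γ : ℕ) (L : P n γ →ₗ[ℝ] ℝ) :
    ∃ p ∈ P n γ, ∀ q (hq : q ∈ P n γ), innerK K p q = L ⟨q, hq⟩ := by
  let B : P n γ →ₗ[ℝ] P n γ →ₗ[ℝ] ℝ := LinearMap.mk₂ ℝ (fun p q => innerK K p q)
    (fun p p' q => by simp [innerK_comm K _ (q : Poly n), innerK_add_right])
    (fun c p q => by
      simp only [Submodule.coe_smul, innerK_comm K _ (q : Poly n), innerK_smul_right, smul_eq_mul])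
    (fun p q q' => by simp [innerK_add_right])
    (fun c p q => by simp only [Submodule.coe_smul, innerK_smul_right, smul_eq_mul])
  have hinj : Function.Injective B := by
    rw [injective_iff_map_eq_zero]
    intro p hp
    have h1 : innerK K (p : Poly n) p = 0 := by simpa [B] using LinearMap.congr_fun hp p
    exact Subtype.ext (eq_zero_of_innerK_self K _ h1)
  have hsurj : Function.Surjective B :=
    (LinearMap.injective_iff_surjective_of_finrank_eq_finrank
      (Subspace.dual_finrank_eq (K := ℝ) (V := P n γ)).symm).1 hinj
  obtain ⟨p, hp⟩ := hsurj L
  exact ⟨p, p.2, fun q hq => by simpa [B] using LinearMap.congr_fun hp ⟨q, hq⟩⟩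

/-! ### Weak gradient and weak divergence

A weak function on `K` is a pair of an interior part and a boundary part. Here both are polynomial:
the boundary part consists of one polynomial for each face, of which only the restriction to that
face matters. -/

/-- `⟨w_b, ς · n_K⟩_{∂K}`. -/
def bdryNormal {n : ℕ} [NeZero n] (K : Element n) (wb : Fin (n + 1) → Poly n)
    (ς : Fin n → Poly n) : ℝ :=
  ∑ i, innerFace K i (wb i) (∑ j, normal K i j • ς j)

/-- `⟨w_b · n_K, ς⟩_{∂K}`. -/
def bdryFlux {n : ℕ} [NeZero n] (K : Element n) (wb : Fin (n + 1) → Fin n → Poly n)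
    (ς : Poly n) : ℝ :=
  ∑ i, innerFace K i (∑ j, normal K i j • wb i j) ς

/-- `G` is the discrete weak gradient of `{w_i, w_b}` of degree `γ`. -/
def IsWeakGrad {n : ℕ} [NeZero n] (K : Element n) (γ : ℕ) (wi : Poly n)
    (wb : Fin (n + 1) → Poly n) (G : Fin n → Poly n) : Prop :=
  G ∈ VecP n γ ∧ ∀ ς ∈ VecP n γ,
    ∑ j, innerK K (G j) (ς j) = -innerK K wi (div ς) + bdryNormal K wb ς

/-- `D` is the discrete weak divergence of `{w_i, w_b}` of degree `γ`. -/
def IsWeakDiv {n : ℕ} [NeZero n] (K : Element n) (γ : ℕ) (wi : Fin n → Poly n)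
    (wb : Fin (n + 1) → Fin n → Poly n) (D : Poly n) : Prop :=
  D ∈ P n γ ∧ ∀ ς ∈ P n γ,
    innerK K D ς = -(∑ j, innerK K (wi j) (MvPolynomial.pderiv j ς)) + bdryFlux K wb ς

lemma exists_isWeakDiv {n : ℕ} [NeZero n] (K : Element n) (γ : ℕ) (wi : Fin n → Poly n)
    (wb : Fin (n + 1) → Fin n → Poly n) : ∃ D, IsWeakDiv K γ wi wb D := by
  let L : P n γ →ₗ[ℝ] ℝ :=
    { toFun := fun ς => -(∑ j, innerK K (wi j) (MvPolynomial.pderiv j (ς : Poly n)))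
        + bdryFlux K wb ς
      map_add' := fun p q => by
        simp only [bdryFlux, Submodule.coe_add, map_add, innerK_add_right, innerFace_add_right,
          Finset.sum_add_distrib]
        ring
      map_smul' := fun c p => by
        simp only [bdryFlux, Submodule.coe_smul, Derivation.map_smul, innerK_smul_right,
          innerFace_smul_right, ← Finset.mul_sum, RingHom.id_apply, smul_eq_mul]
        ring }
  obtain ⟨D, hD, h⟩ := exists_riesz K γ L
  exact ⟨D, hD, fun ς hς => h ς hς⟩

lemma innerK_sum_right {n : ℕ} (K : Element n) (p : Poly n) {ι : Type*} (s : Finset ι)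
    (q : ι → Poly n) : innerK K p (∑ j ∈ s, q j) = ∑ j ∈ s, innerK K p (q j) :=
  map_sum ({ toFun := innerK K p
             map_zero' := by simp [innerK, val]
             map_add' := innerK_add_right K p } : Poly n →+ ℝ) q s

lemma innerFace_sum_right {n : ℕ} [NeZero n] (K : Element n) (i : Fin (n + 1)) (p : Poly n)
    {ι : Type*} (s : Finset ι) (q : ι → Poly n) :
    innerFace K i p (∑ j ∈ s, q j) = ∑ j ∈ s, innerFace K i p (q j) :=
  map_sum ({ toFun := innerFace K i p
             map_zero' := by simp [innerFace, val]
             map_add' := innerFace_add_right K i p } : Poly n →+ ℝ) q s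

lemma exists_isWeakGrad {n : ℕ} [NeZero n] (K : Element n) (γ : ℕ) (wi : Poly n)
    (wb : Fin (n + 1) → Poly n) : ∃ G, IsWeakGrad K γ wi wb G := by
  have key : ∀ j : Fin n, ∃ p ∈ P n γ, ∀ q ∈ P n γ, innerK K p q =
      -innerK K wi (MvPolynomial.pderiv j q)
        + ∑ i, innerFace K i (wb i) (normal K i j • q) := by
    intro j
    let L : P n γ →ₗ[ℝ] ℝ :=
      { toFun := fun q => -innerK K wi (MvPolynomial.pderiv j (q : Poly n))
          + ∑ i, innerFace K i (wb i) (normal K i j • (q : Poly n))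
        map_add' := fun p q => by
          simp only [Submodule.coe_add, map_add, innerK_add_right, smul_add, innerFace_add_right,
            Finset.sum_add_distrib]
          ring
        map_smul' := fun c p => by
          simp only [Submodule.coe_smul, Derivation.map_smul, innerK_smul_right, smul_comm _ c,
            innerFace_smul_right, ← Finset.mul_sum, RingHom.id_apply, smul_eq_mul]
          ring }
    obtain ⟨p, hp, h⟩ := exists_riesz K γ L
    exact ⟨p, hp, fun q hq => h q hq⟩
  choose G hG h using key
  refine ⟨G, fun j _ => hG j, fun ς hς => ?_⟩
  have hς' : ∀ j, ς j ∈ P n γ := fun j => hς j (Set.mem_univ j)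
  simp only [h _ _ (hς' _), div, bdryNormal, innerK_sum_right, innerFace_sum_right,
    Finset.sum_add_distrib, Finset.sum_neg_distrib]
  rw [Finset.sum_comm]

/-- The weak gradient is unique. -/
lemma IsWeakGrad.unique {n : ℕ} [NeZero n] {K : Element n} {γ : ℕ} {wi : Poly n}
    {wb : Fin (n + 1) → Poly n} {G G' : Fin n → Poly n} (h : IsWeakGrad K γ wi wb G)
    (h' : IsWeakGrad K γ wi wb G') : G = G' := by
  have hd : G - G' ∈ VecP n γ := sub_mem h.1 h'.1
  have e := (h.2 _ hd).trans (h'.2 _ hd).symm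
  have hlin : ∀ p q r : Poly n, innerK K (p - q) r = innerK K p r - innerK K q r := by
    intro p q r
    have := innerK_add_right K r (p - q) q
    rw [sub_add_cancel] at this
    rw [innerK_comm K (p - q), innerK_comm K p, innerK_comm K q]
    linarith
  have e' : ∑ j, innerK K ((G - G') j) ((G - G') j) = 0 := by
    conv_lhs => enter [2, j]; rw [Pi.sub_apply, hlin]
    rw [Finset.sum_sub_distrib]
    exact sub_eq_zero.2 e
  have hz := (Finset.sum_eq_zero_iff_of_nonneg
    fun j _ => integral_nonneg fun x => mul_self_nonneg _).1 e'
  funext j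
  exact sub_eq_zero.1 (eq_zero_of_innerK_self K _ (hz j (Finset.mem_univ j)))

/-- The weak divergence is unique. -/
lemma IsWeakDiv.unique {n : ℕ} [NeZero n] {K : Element n} {γ : ℕ} {wi : Fin n → Poly n}
    {wb : Fin (n + 1) → Fin n → Poly n} {D D' : Poly n} (h : IsWeakDiv K γ wi wb D)
    (h' : IsWeakDiv K γ wi wb D') : D = D' := by
  have hd : D - D' ∈ P n γ := sub_mem h.1 h'.1
  have e := (h.2 _ hd).trans (h'.2 _ hd).symm
  rw [innerK_comm K D, innerK_comm K D'] at e
  have := innerK_add_right K (D - D') (D - D') D'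
  rw [sub_add_cancel] at this
  exact sub_eq_zero.1 (eq_zero_of_innerK_self K _ (by linarith))

/-- The discrete weak gradient `∇_{w,γ} {w_i, w_b}` on `K`. -/
def weakGrad {n : ℕ} [NeZero n] (K : Element n) (γ : ℕ) (wi : Poly n)
    (wb : Fin (n + 1) → Poly n) : Fin n → Poly n :=
  (exists_isWeakGrad K γ wi wb).choose

/-- The discrete weak divergence `∇_{w,γ} · {w_i, w_b}` on `K`. -/
def weakDiv {n : ℕ} [NeZero n] (K : Element n) (γ : ℕ) (wi : Fin n → Poly n)
    (wb : Fin (n + 1) → Fin n → Poly n) : Poly n :=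
  (exists_isWeakDiv K γ wi wb).choose

lemma weakGrad_spec {n : ℕ} [NeZero n] (K : Element n) (γ : ℕ) (wi : Poly n)
    (wb : Fin (n + 1) → Poly n) : IsWeakGrad K γ wi wb (weakGrad K γ wi wb) :=
  (exists_isWeakGrad K γ wi wb).choose_spec

lemma weakDiv_spec {n : ℕ} [NeZero n] (K : Element n) (γ : ℕ) (wi : Fin n → Poly n)
    (wb : Fin (n + 1) → Fin n → Poly n) : IsWeakDiv K γ wi wb (weakDiv K γ wi wb) :=
  (exists_isWeakDiv K γ wi wb).choose_spec

/-- The weak gradient of a vector-valued weak function, row `l` being that of the component `l`. -/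
def vecWeakGrad {n : ℕ} [NeZero n] (K : Element n) (γ : ℕ) (wi : Fin n → Poly n)
    (wb : Fin (n + 1) → Fin n → Poly n) : Fin n → Fin n → Poly n :=
  fun l => weakGrad K γ (wi l) fun i => wb i l

/-- The weak divergence of a matrix-valued weak function, taken row by row. -/
def matWeakDiv {n : ℕ} [NeZero n] (K : Element n) (γ : ℕ) (wi : Fin n → Fin n → Poly n)
    (wb : Fin (n + 1) → Fin n → Fin n → Poly n) : Fin n → Poly n :=
  fun l => weakDiv K γ (wi l) fun i => wb i l

/-- `(v, w)_K` for vector fields. -/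
def vecInnerK {n : ℕ} (K : Element n) (v w : Fin n → Poly n) : ℝ := ∑ j, innerK K (v j) (w j)

/-- `(A, B)_K` for matrix fields. -/
def matInnerK {n : ℕ} (K : Element n) (A B : Fin n → Fin n → Poly n) : ℝ :=
  ∑ l, vecInnerK K (A l) (B l)

/-- `u ⊗ v = (u_l v_j)`. -/
def tensor {n : ℕ} (u v : Fin n → Poly n) : Fin n → Fin n → Poly n := fun l j => u l * v j

/-! ### The `L²` projection on the faces -/

/-- The trace on a face of a polynomial, as an element of `L²(e)`. -/
def trace {n : ℕ} [NeZero n] (K : Element n) (i : Fin (n + 1)) :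
    Poly n →ₗ[ℝ] Lp ℝ 2 (faceMeasure K i) where
  toFun p := MemLp.toLp (val p) (((memLp_two_iff_integrable_sq
    (continuous_val p).aestronglyMeasurable).2 (by
      simpa only [sq] using integrable_face K i p p)))
  map_add' p q := by
    rw [← MemLp.toLp_add]
    exact MemLp.toLp_congr _ _ (Filter.Eventually.of_forall fun x => val_add p q x)
  map_smul' c p := by
    rw [RingHom.id_apply, ← MemLp.toLp_const_smul]
    exact MemLp.toLp_congr _ _ (Filter.Eventually.of_forall fun x => val_smul c p x)

/-- `P_k(e)` as a subspace of `L²(e)`. -/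
def traceSpace {n : ℕ} [NeZero n] (K : Element n) (k : ℕ) (i : Fin (n + 1)) :
    Submodule ℝ (Lp ℝ 2 (faceMeasure K i)) :=
  (P n k).map (trace K i)

instance {n : ℕ} [NeZero n] (K : Element n) (k : ℕ) (i : Fin (n + 1)) :
    FiniteDimensional ℝ (traceSpace K k i) := by
  unfold traceSpace
  infer_instance

instance {n : ℕ} [NeZero n] (K : Element n) (k : ℕ) (i : Fin (n + 1)) :
    CompleteSpace (traceSpace K k i) :=
  FiniteDimensional.complete ℝ _

/-- `Π_k^B` on a face: the `L²(e)`-orthogonal projection onto `P_k(e)`, of the trace of `p`. -/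
def faceProj {n : ℕ} [NeZero n] (K : Element n) (k : ℕ) (i : Fin (n + 1)) (p : Poly n) :
    Lp ℝ 2 (faceMeasure K i) :=
  (traceSpace K k i).starProjection (trace K i p)

/-- `⟨η Π_k^B u, Π_k^B v⟩_{∂K}` with `η = h_K⁻¹`. -/
def stab {n : ℕ} [NeZero n] (K : Element n) (k : ℕ) (u v : Fin n → Poly n) : ℝ :=
  ∑ i, ∑ j, (hK K)⁻¹ * inner ℝ (faceProj K k i (u j)) (faceProj K k i (v j))

/-! ### The local problem -/

/-- `a_{h,K}(u, v)`. -/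
def aK {n : ℕ} [NeZero n] (K : Element n) (m k : ℕ) (ν : ℝ) (u v : Fin n → Poly n) : ℝ :=
  ν * matInnerK K (vecWeakGrad K (m - 1) u 0) (vecWeakGrad K (m - 1) v 0) + ν * stab K k u v

/-- `b_{h,K}(v, p)`. -/
def bK {n : ℕ} [NeZero n] (K : Element n) (m : ℕ) (v : Fin n → Poly n) (p : Poly n) : ℝ :=
  vecInnerK K (weakGrad K m p 0) v

/-- `c_{h,K}(κ; u, v)`. -/
def cK {n : ℕ} (K : Element n) (α r : ℝ) (κ u v : Fin n → Poly n) : ℝ :=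
  ∫ x in K.closedInterior, α * ‖vecVal κ x‖ ^ (r - 2) * inner ℝ (vecVal u x) (vecVal v x)

/-- `d_{h,K}(κ; u, v)`. -/
def dK {n : ℕ} [NeZero n] (K : Element n) (m : ℕ) (κ u v : Fin n → Poly n) : ℝ :=
  1 / 2 * vecInnerK K (matWeakDiv K m (tensor u κ) 0) v
    - 1 / 2 * vecInnerK K (matWeakDiv K m (tensor v κ) 0) u

/-- `F_{h,K}(v)`, for the traces `u_b` and `p_b`; `ub i` and `pb i` are the traces on the face
opposite to the vertex `i`. -/
def FK {n : ℕ} [NeZero n] (K : Element n) (m k : ℕ) (ν : ℝ)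
    (f : EuclideanSpace ℝ (Fin n) → EuclideanSpace ℝ (Fin n))
    (ub : Fin (n + 1) → Fin n → Poly n) (pb : Fin (n + 1) → Poly n) (v : Fin n → Poly n) : ℝ :=
  (∫ x in K.closedInterior, inner ℝ (f x) (vecVal v x))
    - ν * matInnerK K (vecWeakGrad K (m - 1) 0 ub) (vecWeakGrad K (m - 1) v 0)
    + ν * ∑ i, ∑ j, (hK K)⁻¹ * inner ℝ (trace K i (ub i j)) (faceProj K k i (v j))
    - 1 / 2 * vecInnerK K (matWeakDiv K m 0 fun i => tensor (ub i) (ub i)) v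
    - vecInnerK K (weakGrad K m 0 pb) v

/-- `(u, p) ∈ [P_m(K)]^n × P_{m-1}(K)` solves the local problem on `K`. -/
def IsLocalSolution {n : ℕ} [NeZero n] (K : Element n) (m k : ℕ) (ν α r : ℝ)
    (f : EuclideanSpace ℝ (Fin n) → EuclideanSpace ℝ (Fin n))
    (ub : Fin (n + 1) → Fin n → Poly n) (pb : Fin (n + 1) → Poly n)
    (u : Fin n → Poly n) (p : Poly n) : Prop :=
  u ∈ VecP n m ∧ p ∈ P n (m - 1) ∧
  (∀ v ∈ VecP n m,
    aK K m k ν u v + bK K m v p + cK K α r u u v + dK K m u u v = FK K m k ν f ub pb v) ∧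
  (∀ q ∈ P n (m - 1), bK K m u q = 0)

/-- `V_{0h,K}`. -/
def V0K {n : ℕ} [NeZero n] (K : Element n) (m : ℕ) : Set (Fin n → Poly n) :=
  {κ | κ ∈ VecP n m ∧ ∀ q ∈ P n (m - 1), bK K m κ q = 0}

/-- `|||v|||_{V,K}`. -/
def normVK {n : ℕ} [NeZero n] (K : Element n) (m k : ℕ) (v : Fin n → Poly n) : ℝ :=
  Real.sqrt (matInnerK K (vecWeakGrad K (m - 1) v 0) (vecWeakGrad K (m - 1) v 0) + stab K k v v)

/-- The quotients whose supremum is `𝒩_{h,K}`. -/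
def quotientsN {n : ℕ} [NeZero n] (K : Element n) (m k : ℕ) : Set ℝ :=
  {t | ∃ κ ∈ V0K K m, ∃ u ∈ V0K K m, ∃ v ∈ V0K K m, κ ≠ 0 ∧ u ≠ 0 ∧ v ≠ 0 ∧
    t = dK K m κ u v / (normVK K m k κ * normVK K m k u * normVK K m k v)}

/-- The quotients whose supremum is `‖F_{h,K}‖_{*,h}`. -/
def quotientsF {n : ℕ} [NeZero n] (K : Element n) (m k : ℕ) (ν : ℝ)
    (f : EuclideanSpace ℝ (Fin n) → EuclideanSpace ℝ (Fin n))
    (ub : Fin (n + 1) → Fin n → Poly n) (pb : Fin (n + 1) → Poly n) : Set ℝ :=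
  {t | ∃ v ∈ V0K K m, v ≠ 0 ∧ t = FK K m k ν f ub pb v / normVK K m k v}

/-- `𝒩_{h,K}`. -/
def NK {n : ℕ} [NeZero n] (K : Element n) (m k : ℕ) : ℝ := sSup (quotientsN K m k)

/-- `‖F_{h,K}‖_{*,h}`. -/
def normFK {n : ℕ} [NeZero n] (K : Element n) (m k : ℕ) (ν : ℝ)
    (f : EuclideanSpace ℝ (Fin n) → EuclideanSpace ℝ (Fin n))
    (ub : Fin (n + 1) → Fin n → Poly n) (pb : Fin (n + 1) → Poly n) : ℝ :=
  sSup (quotientsF K m k ν f ub pb)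

end

end WG

/-!
The weak gradients in `b` and the weak divergences in `d` are eliminated through their
definition. On `[P_m(K)]ⁿ` one finds `b(v, q) = -(q, ∇·v)`, and `d(κ; u, v)` becomes half the
difference of `∑ (vₗ κⱼ, ∂ⱼ uₗ)` and `∑ (uₗ κⱼ, ∂ⱼ vₗ)`, which is skew-symmetric in `u` and `v`
(`WG.dK_eq`). All forms live on a finite-dimensional space, so that only four facts are needed.

* `|||·|||` is a norm on `[P_m(K)]ⁿ` (`WG.normVK_pos`). If the weak gradient and the projected
  traces of `p ∈ P_m` vanish, integration by parts gives `‖∂ⱼ p‖² = 0` for each `j`, and the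
  constant `p` has mean value zero on the faces. The only part of Green's formula used is that
  `∫_K ∂ⱼ g = 0` whenever all face integrals of `g` vanish (`WG.integral_pderiv_eq_zero`). It
  follows from Fubini's theorem on the reference simplex, and from the fact that surface measure
  on a face is a nonzero multiple of Lebesgue measure in affine coordinates. Since the forms are continuous,
  `𝒩` and `‖F‖` are finite.
* Existence of the velocity in `V₀` (`exists_variational_solution`). Tested with `u` itself, the
  equation loses its convection term and is coercive, so that the corresponding vector field points
  outwards on large spheres, and has a zero by Brouwer's theorem. The latter is obtained from
  the volume argument of Milnor and Rogers: if there were no zero, one would have a map `id + h`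
  from the ball to the sphere, with `h` zero on the sphere, and its Jacobian would vanish; but the
  integral of `det (1 + t Dh)` over the ball is a polynomial in `t`, equal to the volume of the
  ball for small `t`, hence also for `t = 1`.
* Existence of the pressure (`WG.exists_pressure`): the residual of the momentum equation vanishes
  on `V₀`, the left kernel of `b`, so it is of the form `b(·, p)`. Its uniqueness
  (`WG.pressure_unique`): the divergence maps `[P_m]ⁿ` onto `P_{m-1}`.
* Uniqueness of the velocity (`WG.velocity_unique`): monotonicity of `c` and skew-symmetry of `d`
  give `ν |||w|||² ≤ d(w; w, u)` for the difference `w` of two velocities, while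
  `ν |||u||| ≤ ‖F‖` by the energy estimate.
-/

/-! ### Zeros of continuous coercive maps in finite dimension -/

section Brouwer

open MeasureTheory Metric Set
open scoped NNReal

section Det

variable {E : Type*} [NormedAddCommGroup E] [NormedSpace ℝ E]

/-- `t ↦ det (1 + t A)` is a polynomial of degree at most the dimension. -/
lemma exists_polynomial_det_id_add_smul [FiniteDimensional ℝ E] (A : E →L[ℝ] E) :
    ∃ p : Polynomial ℝ, p.natDegree ≤ Module.finrank ℝ E ∧
      ∀ t : ℝ, p.eval t = (ContinuousLinearMap.id ℝ E + t • A).det := by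
  classical
  let b := Module.finBasis ℝ E
  let M := LinearMap.toMatrix b b (A : E →ₗ[ℝ] E)
  refine ⟨Matrix.det ((Polynomial.X : Polynomial ℝ) • M.map Polynomial.C
    + (1 : Matrix _ _ ℝ).map Polynomial.C), ?_, fun t => ?_⟩
  · simpa using Polynomial.natDegree_det_X_add_C_le M 1
  · rw [← Polynomial.coe_evalRingHom, RingHom.map_det, ContinuousLinearMap.det,
      ← LinearMap.det_toMatrix b]
    congr 1
    ext i j
    simp [M, Matrix.one_apply, apply_ite (Polynomial.eval t), add_comm, mul_comm t]

lemma det_id_add_smul_pos [FiniteDimensional ℝ E] (A : E →L[ℝ] E) {t : ℝ} (ht : 0 ≤ t)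
    (hA : t * ‖A‖ < 1) :
    0 < (ContinuousLinearMap.id ℝ E + t • A).det := by
  obtain ⟨p, -, hp⟩ := exists_polynomial_det_id_add_smul A
  rw [← hp]
  by_contra! hneg
  have h0 : p.eval 0 = 1 := by simp [hp, ContinuousLinearMap.det]
  obtain ⟨s, hs, hs0⟩ := intermediate_value_Icc' ht p.continuous.continuousOn
    (show (0 : ℝ) ∈ Icc (p.eval t) (p.eval 0) from ⟨hneg, by simp [h0]⟩)
  simp only [hp] at hs0
  obtain ⟨x, hx, hx0⟩ :=
    (Submodule.ne_bot_iff _).1 (LinearMap.bot_lt_ker_of_det_eq_zero hs0).ne'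
  have hx' : x = -(s • A x) := by
    rw [LinearMap.mem_ker] at hx
    exact eq_neg_of_add_eq_zero_left (by simpa using hx)
  have hn : ‖x‖ ≤ s * ‖A‖ * ‖x‖ := by
    calc ‖x‖ = s * ‖A x‖ := by
          conv_lhs => rw [hx']
          rw [norm_neg, norm_smul, Real.norm_of_nonneg hs.1]
      _ ≤ s * (‖A‖ * ‖x‖) := by gcongr; exacts [hs.1, A.le_opNorm x]
      _ = _ := by ring
  have hlt : s * ‖A‖ < 1 := lt_of_le_of_lt (by gcongr; exact hs.2) hA
  nlinarith [norm_pos_iff.2 hx0]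

/-- A map vanishing outside a ball and Lipschitz on this ball is Lipschitz. -/
lemma lipschitzWith_of_lipschitzOnWith_closedBall {F : Type*} [NormedAddCommGroup F]
    {h : E → F} {R : ℝ} {C : ℝ≥0}
    (hC : LipschitzOnWith C h (closedBall 0 R)) (h0 : ∀ x, R ≤ ‖x‖ → h x = 0) :
    LipschitzWith C h := by
  -- If `x` is in the ball and `y` is not, the segment from `x` to `y` meets the sphere.
  have key : ∀ x y, ‖x‖ ≤ R → R ≤ ‖y‖ → dist (h x) (h y) ≤ C * dist x y := by
    intro x y hx hy
    have hc : ContinuousOn (fun t : ℝ => ‖AffineMap.lineMap x y t‖) (Icc 0 1) := by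
      fun_prop
    obtain ⟨t, ht, hz⟩ := intermediate_value_Icc zero_le_one hc
      (show R ∈ _ by simpa using ⟨hx, hy⟩)
    rw [h0 y hy, ← h0 _ hz.ge]
    refine (hC.dist_le_mul x (by simpa using hx) _ (by simpa using hz.le)).trans ?_
    gcongr
    rw [dist_left_lineMap, Real.norm_of_nonneg ht.1]
    exact mul_le_of_le_one_left dist_nonneg ht.2
  refine LipschitzWith.of_dist_le_mul fun x y => ?_
  rcases le_total ‖x‖ R with hx | hx <;> rcases le_total ‖y‖ R with hy | hy
  · exact hC.dist_le_mul x (by simpa using hx) y (by simpa using hy)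
  · exact key x y hx hy
  · rw [dist_comm, dist_comm x]
    exact key y x hy hx
  · rw [h0 x hx, h0 y hy, dist_self]
    positivity

/-- If `h` is `C`-Lipschitz and vanishes outside a ball, then for `t C < 1` the map `id + t h` is
a bijection which preserves the ball. -/
lemma injective_and_image_ball_id_add_smul [CompleteSpace E] {h : E → E} {R : ℝ} {C : ℝ≥0}
    (hC : LipschitzWith C h) (h0 : ∀ x, R ≤ ‖x‖ → h x = 0) {t : ℝ} (ht : 0 ≤ t)
    (htC : t * C < 1) :
    Function.Injective (fun x => x + t • h x) ∧
      (fun x => x + t • h x) '' ball 0 R = ball 0 R := by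
  have hap : ApproximatesLinearOn (fun x => x + t • h x)
      ((ContinuousLinearEquiv.refl ℝ E : E ≃L[ℝ] E) : E →L[ℝ] E) univ (t.toNNReal * C) := by
    intro x _ y _
    have hxy : x + t • h x - (y + t • h y)
        - ((ContinuousLinearEquiv.refl ℝ E : E ≃L[ℝ] E) : E →L[ℝ] E) (x - y)
        = t • (h x - h y) := by
      simp only [ContinuousLinearEquiv.coe_refl, ContinuousLinearMap.coe_id', id_eq, smul_sub]
      abel
    rw [hxy, norm_smul, Real.norm_of_nonneg ht, NNReal.coe_mul, Real.coe_toNNReal _ ht, mul_assoc]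
    gcongr
    simpa [dist_eq_norm] using hC.dist_le_mul x y
  have hc : Subsingleton E ∨ t.toNNReal * C <
      ‖((ContinuousLinearEquiv.refl ℝ E).symm : E →L[ℝ] E)‖₊⁻¹ := by
    rcases subsingleton_or_nontrivial E with hE | hE
    · exact Or.inl hE
    · right
      have : ‖((ContinuousLinearEquiv.refl ℝ E).symm : E →L[ℝ] E)‖₊ = 1 := by
        ext
        simp
      rw [this, inv_one, ← NNReal.coe_lt_coe]
      simpa [Real.coe_toNNReal _ ht] using htC
  have hinj : Function.Injective (fun x => x + t • h x) :=
    injOn_univ.1 (hap.injOn hc)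
  have hbij : Function.Bijective (fun x => x + t • h x) := ⟨hinj, hap.surjective hc⟩
  refine ⟨hinj, ?_⟩
  have hcompl : (fun x => x + t • h x) '' (ball 0 R)ᶜ = (ball 0 R)ᶜ := by
    refine (image_congr fun x hx => ?_).trans (image_id _)
    rw [h0 x (by simpa using hx)]
    simp
  rwa [image_compl_eq hbij, compl_inj_iff] at hcompl

end Det

variable {E : Type*} [NormedAddCommGroup E] [InnerProductSpace ℝ E]

/-- The derivative of a map into a sphere is nowhere surjective. -/
lemma det_eq_zero_of_hasFDerivAt_of_norm_eq [FiniteDimensional ℝ E] {g : E → E} {R : ℝ}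
    (hR : 0 < R) (hg : ∀ x, ‖g x‖ = R) {x : E} {D : E →L[ℝ] E} (hD : HasFDerivAt g D x) :
    D.det = 0 := by
  by_contra hdet
  have hperp : ∀ v, inner ℝ (g x) (D v) = 0 := by
    intro v
    have h1 := hD.inner ℝ hD
    simp only [real_inner_self_eq_norm_sq, hg] at h1
    have h2 := congrArg (fun L : E →L[ℝ] ℝ => L v) (h1.unique (hasFDerivAt_const (R ^ 2) x))
    simp [fderivInnerCLM_apply, real_inner_comm (g x) (D v)] at h2
    linarith
  have hsurj : LinearMap.range (D : E →ₗ[ℝ] E) = ⊤ := by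
    by_contra hlt
    exact hdet (by
      by_contra h
      exact hlt (LinearMap.range_eq_top.2
        ((LinearEquiv.ofIsUnitDet (f := (D : E →ₗ[ℝ] E)) (v := Module.finBasis ℝ E)
          (v' := Module.finBasis ℝ E) (by
            rw [LinearMap.det_toMatrix]; exact (Ne.isUnit h))).surjective)))
  obtain ⟨v, hv⟩ := LinearMap.range_eq_top.1 hsurj (g x)
  have hv' : D v = g x := hv
  have := hperp v
  rw [hv', real_inner_self_eq_norm_sq, hg] at this
  exact (pow_pos hR 2).ne' this

/-- Let `h` be Lipschitz, differentiable in a ball, and zero outside. The integral over the ball of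
the Jacobian of `id + t h` is a polynomial in `t`; for small `t` it is the volume of the ball, as
`id + t h` is then a bijection of the ball. So it is this volume for all `t`, in particular for
`t = 1`. -/
lemma integral_det_id_add_fderiv [FiniteDimensional ℝ E] [MeasurableSpace E] [BorelSpace E]
    {h : E → E} {R : ℝ}
    {C : ℝ≥0} (hC : LipschitzWith C h) (h0 : ∀ x, R ≤ ‖x‖ → h x = 0)
    (hd : ∀ x ∈ ball (0 : E) R, DifferentiableAt ℝ h x) :
    ∫ x in ball (0 : E) R, (ContinuousLinearMap.id ℝ E + fderiv ℝ h x).det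
      = volume.real (ball (0 : E) R) := by
  have hA : ∀ x ∈ ball (0 : E) R, ‖fderiv ℝ h x‖ ≤ C := fun x hx =>
    (hd x hx).hasFDerivAt.le_of_lipschitz hC
  have hsmall : ∀ t : ℝ, 0 ≤ t → t * C < 1 →
      IntegrableOn (fun x => (ContinuousLinearMap.id ℝ E + t • fderiv ℝ h x).det) (ball 0 R) ∧
      ∫ x in ball (0 : E) R, (ContinuousLinearMap.id ℝ E + t • fderiv ℝ h x).det
        = volume.real (ball (0 : E) R) := by
    intro t ht htC
    obtain ⟨hinj, himg⟩ := injective_and_image_ball_id_add_smul hC h0 ht htC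
    have hder : ∀ x ∈ ball (0 : E) R, HasFDerivWithinAt (fun x => x + t • h x)
        (ContinuousLinearMap.id ℝ E + t • fderiv ℝ h x) (ball 0 R) x := fun x hx =>
      ((hasFDerivAt_id x).add ((hd x hx).hasFDerivAt.const_smul t)).hasFDerivWithinAt
    have habs : ∀ x ∈ ball (0 : E) R,
        |(ContinuousLinearMap.id ℝ E + t • fderiv ℝ h x).det| • (1 : ℝ)
          = (ContinuousLinearMap.id ℝ E + t • fderiv ℝ h x).det := by
      intro x hx
      rw [smul_eq_mul, mul_one, abs_of_pos]
      exact det_id_add_smul_pos _ ht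
        (lt_of_le_of_lt (mul_le_mul_of_nonneg_left (hA x hx) ht) htC)
    constructor
    · have := (integrableOn_image_iff_integrableOn_abs_det_fderiv_smul volume
        measurableSet_ball hder hinj.injOn (fun _ => (1 : ℝ))).1
        (by rw [himg]; exact integrableOn_const measure_ball_lt_top.ne)
      exact this.congr_fun habs measurableSet_ball
    · rw [← setIntegral_congr_fun measurableSet_ball habs,
        ← integral_image_eq_integral_abs_det_fderiv_smul volume measurableSet_ball hder
          hinj.injOn (fun _ => (1 : ℝ)), himg]
      simp
  -- Lagrange interpolation at `d + 1` small nodes.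
  set d := Module.finrank ℝ E
  let s := Finset.range (d + 1)
  let τ : ℕ → ℝ := fun i => i / ((d + 1) * (C + 1))
  have hτinj : Set.InjOn τ s := by
    intro i _ j _ hij
    have hpos : (0 : ℝ) < (d + 1) * (C + 1) := by positivity
    simpa [τ, div_left_inj' hpos.ne'] using hij
  have hτ0 : ∀ i, 0 ≤ τ i := fun i => by positivity
  have hτC : ∀ i ∈ s, τ i * C < 1 := by
    intro i hi
    have hi' : (i : ℝ) < d + 1 := by
      have := Finset.mem_range.1 hi
      exact_mod_cast this
    have hpos : (0 : ℝ) < (d + 1) * (C + 1) := by positivity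
    rw [div_mul_eq_mul_div, div_lt_one hpos]
    have hC0 : (0 : ℝ) ≤ C := C.2
    nlinarith
  let c : ℕ → ℝ := fun i => (Lagrange.basis s τ i).eval 1
  have hc : ∑ i ∈ s, c i = 1 := by
    rw [← Polynomial.eval_finsetSum, Lagrange.sum_basis hτinj ⟨0, by simp [s]⟩,
      Polynomial.eval_one]
  have hpt : ∀ A : E →L[ℝ] E, (ContinuousLinearMap.id ℝ E + A).det
      = ∑ i ∈ s, (ContinuousLinearMap.id ℝ E + τ i • A).det * c i := by
    intro A
    obtain ⟨p, hdeg, hp⟩ := exists_polynomial_det_id_add_smul A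
    have hint : p = Lagrange.interpolate s τ fun i => p.eval (τ i) := by
      refine Lagrange.eq_interpolate hτinj ?_
      refine lt_of_le_of_lt Polynomial.degree_le_natDegree ?_
      rw [Finset.card_range]
      exact_mod_cast Nat.lt_succ_of_le hdeg
    have h1 : p.eval 1 = (ContinuousLinearMap.id ℝ E + A).det := by rw [hp, one_smul]
    have h2 := congrArg (Polynomial.eval 1) hint
    rw [Lagrange.interpolate_apply, Polynomial.eval_finsetSum, h1] at h2
    simpa only [Polynomial.eval_mul, Polynomial.eval_C, hp] using h2
  rw [funext fun x => hpt (fderiv ℝ h x), integral_finsetSum _ fun i hi =>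
    ((hsmall _ (hτ0 i) (hτC i hi)).1.mul_const _)]
  calc ∑ i ∈ s, ∫ x in ball (0 : E) R,
        (ContinuousLinearMap.id ℝ E + τ i • fderiv ℝ h x).det * c i
      = ∑ i ∈ s, volume.real (ball (0 : E) R) * c i := by
        refine Finset.sum_congr rfl fun i hi => ?_
        rw [integral_mul_const, (hsmall _ (hτ0 i) (hτC i hi)).2]
    _ = _ := by rw [← Finset.mul_sum, hc, mul_one]

/-- A `C¹` map which is the identity outside a ball has a zero. Otherwise its normalisation
`R H / ‖H‖` would be a retraction of the ball onto the sphere, whose Jacobian vanishes; but the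
Jacobian has the same integral as that of the identity. -/
lemma exists_zero_of_contDiff_of_eq_id [FiniteDimensional ℝ E] {H : E → E} {R : ℝ} (hR : 0 < R)
    (hH : ContDiff ℝ 1 H) (hid : ∀ x, R ≤ ‖x‖ → H x = x) : ∃ x, H x = 0 := by
  by_contra! hne
  borelize E
  let g : E → E := fun x => (R / ‖H x‖) • H x
  have hg : ContDiff ℝ 1 g := (contDiff_const.div (hH.norm ℝ hne)
    fun x => norm_ne_zero_iff.2 (hne x)).smul hH
  have hgn : ∀ x, ‖g x‖ = R := fun x => by
    simp only [g]
    rw [norm_smul, Real.norm_of_nonneg (by positivity),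
      div_mul_cancel₀ _ (norm_ne_zero_iff.2 (hne x))]
  let h : E → E := (closedBall (0 : E) R).indicator fun x => g x - x
  have hin : ∀ x, ‖x‖ ≤ R → h x = g x - x := fun x hx =>
    indicator_of_mem (by simpa using hx) _
  have h0 : ∀ x, R ≤ ‖x‖ → h x = 0 := by
    intro x hx
    rcases hx.lt_or_eq with hx' | hx'
    · exact indicator_of_notMem (by simpa using hx') _
    · rw [hin x hx'.ge]
      simp [g, hid x hx, ← hx', hR.ne']
  obtain ⟨C, hC⟩ := ContDiffOn.exists_lipschitzOnWith
    ((hg.sub contDiff_id).contDiffOn (s := closedBall (0 : E) R)) one_ne_zero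
    (convex_closedBall _ _) (isCompact_closedBall _ _)
  have hCh : LipschitzWith C h := by
    refine lipschitzWith_of_lipschitzOnWith_closedBall (fun x hx y hy => ?_) h0
    rw [hin x (by simpa using hx), hin y (by simpa using hy)]
    exact hC hx hy
  have hder : ∀ x ∈ ball (0 : E) R,
      HasFDerivAt h (fderiv ℝ g x - ContinuousLinearMap.id ℝ E) x := by
    intro x hx
    have : HasFDerivAt (fun x => g x - x) (fderiv ℝ g x - ContinuousLinearMap.id ℝ E) x :=
      ((hg.differentiable one_ne_zero) x).hasFDerivAt.sub (hasFDerivAt_id x)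
    refine this.congr_of_eventuallyEq ?_
    filter_upwards [isOpen_ball.mem_nhds hx] with y hy
    exact hin y (by simpa using (mem_ball.1 hy).le)
  have hint := integral_det_id_add_fderiv hCh h0 fun x hx => (hder x hx).differentiableAt
  have hzero : ∀ x ∈ ball (0 : E) R,
      (ContinuousLinearMap.id ℝ E + fderiv ℝ h x).det = 0 := by
    intro x hx
    rw [(hder x hx).fderiv, add_sub_cancel]
    exact det_eq_zero_of_hasFDerivAt_of_norm_eq hR hgn
      ((hg.differentiable one_ne_zero) x).hasFDerivAt
  rw [setIntegral_congr_fun measurableSet_ball hzero] at hint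
  simp only [integral_zero] at hint
  have hpos : 0 < volume.real (ball (0 : E) R) :=
    ENNReal.toReal_pos (measure_ball_pos _ _ hR).ne' measure_ball_lt_top.ne
  exact hpos.ne hint

/-- A continuous vector field pointing outwards on all large spheres has a zero. -/
theorem exists_zero_of_continuous_of_inner_pos [FiniteDimensional ℝ E] {G : E → E} {R : ℝ}
    (hR : 0 < R) (hG : Continuous G) (hpos : ∀ x, R ≤ ‖x‖ → 0 < inner ℝ (G x) x) :
    ∃ x, G x = 0 := by
  by_contra! hne
  -- Deform `G` to the identity across a spherical shell, then smooth it.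
  let χ : E → ℝ := fun x => max 0 (min 1 (R + 1 - ‖x‖))
  have hχ0 : ∀ x, 0 ≤ χ x := fun x => le_max_left _ _
  have hχ1 : ∀ x, χ x ≤ 1 := fun x => max_le zero_le_one (min_le_left _ _)
  have hχin : ∀ x, ‖x‖ ≤ R → χ x = 1 := fun x hx => by
    simp only [χ]
    rw [min_eq_left (by linarith), max_eq_right zero_le_one]
  have hχout : ∀ x, R + 1 ≤ ‖x‖ → χ x = 0 := fun x hx => by
    simp only [χ]
    exact max_eq_left ((min_le_right _ _).trans (by linarith))
  let H : E → E := fun x => χ x • G x + (1 - χ x) • x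
  have hHc : Continuous H := by
    have : Continuous χ := by fun_prop
    fun_prop
  have hHne : ∀ x, H x ≠ 0 := by
    intro x hx
    rcases le_total ‖x‖ R with hxR | hxR
    · simp only [H, hχin x hxR, one_smul, sub_self, zero_smul, add_zero] at hx
      exact hne x hx
    · have h1 : inner ℝ (H x) x = χ x * inner ℝ (G x) x + (1 - χ x) * ‖x‖ ^ 2 := by
        simp only [H, inner_add_left, real_inner_smul_left, real_inner_self_eq_norm_sq]
      rw [hx, inner_zero_left] at h1
      have h2 := hpos x hxR
      have h3 : 0 < ‖x‖ ^ 2 := pow_pos (hR.trans_le hxR) 2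
      rcases (hχ0 x).eq_or_lt with hz | hz
      · rw [← hz] at h1
        linarith
      · nlinarith [mul_pos hz h2, mul_nonneg (sub_nonneg.2 (hχ1 x)) h3.le]
  have hHid : ∀ x, R + 1 ≤ ‖x‖ → H x = x := fun x hx => by
    simp [H, hχout x hx]
  obtain ⟨g, hg, hgε, hgS, -⟩ := hHc.exists_contDiff_approx_and_eqOn 1 hHc.norm
    (fun x => norm_pos_iff.2 (hHne x)) (S := {x | R + 2 ≤ ‖x‖}) (U := {x | R + 1 < ‖x‖})
    (isClosed_le continuous_const continuous_norm)
    ((isOpen_lt continuous_const continuous_norm).mem_nhdsSet.2 fun x hx => by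
      have : R + 2 ≤ ‖x‖ := hx
      show R + 1 < ‖x‖
      linarith)
    (contDiffOn_id.congr fun x hx => hHid x (le_of_lt hx))
  obtain ⟨x, hx⟩ := exists_zero_of_contDiff_of_eq_id (R := R + 2) (by linarith) hg fun x hx =>
    (hgS hx).trans (hHid x (by linarith))
  have := hgε x
  rw [hx, dist_zero_left] at this
  exact lt_irrefl _ this

end Brouwer

/-! ### Nonlinear variational problems in finite dimension -/

section Variational

variable {E : Type*} [NormedAddCommGroup E] [InnerProductSpace ℝ E] [FiniteDimensional ℝ E]

lemma exists_pos_mul_norm_sq_le (A : E →ₗ[ℝ] E →ₗ[ℝ] ℝ) (hA : ∀ x, x ≠ 0 → 0 < A x x) :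
    ∃ δ > 0, ∀ x, δ * ‖x‖ ^ 2 ≤ A x x := by
  have hc : Continuous fun x => A x x := by
    have : Continuous fun x => A.toContinuousBilinearMap x x := by fun_prop
    simpa using this
  rcases (Metric.sphere (0 : E) 1).eq_empty_or_nonempty with h | h
  · refine ⟨1, one_pos, fun x => ?_⟩
    have hx : x = 0 := by
      by_contra hx
      have : (‖x‖⁻¹ • x) ∈ Metric.sphere (0 : E) 1 := by
        simp [norm_smul, hx]
      simp [h] at this
    simp [hx]
  · obtain ⟨x₀, hx₀, hmin⟩ := (isCompact_sphere (0 : E) 1).exists_isMinOn h hc.continuousOn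
    refine ⟨A x₀ x₀, hA _ (by rintro rfl; simp at hx₀), fun x => ?_⟩
    rcases eq_or_ne x 0 with rfl | hx
    · simp
    · have hm : (‖x‖⁻¹ • x) ∈ Metric.sphere (0 : E) 1 := by simp [norm_smul, hx]
      have h1 : A x₀ x₀ ≤ A (‖x‖⁻¹ • x) (‖x‖⁻¹ • x) := hmin hm
      have hn := norm_pos_iff.2 hx
      simp only [map_smul, LinearMap.smul_apply, smul_eq_mul] at h1
      calc A x₀ x₀ * ‖x‖ ^ 2 ≤ (‖x‖⁻¹ * (‖x‖⁻¹ * A x x)) * ‖x‖ ^ 2 := by gcongr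
        _ = A x x := by field_simp

lemma exists_abs_le_mul_norm (F : E →ₗ[ℝ] ℝ) : ∃ M, 0 ≤ M ∧ ∀ x, |F x| ≤ M * ‖x‖ :=
  ⟨‖F.toContinuousLinearMap‖, norm_nonneg _, fun x => F.toContinuousLinearMap.le_opNorm x⟩

-- Needed for the operator norm on `E →L[ℝ] E →L[ℝ] E →L[ℝ] ℝ`.
set_option maxSynthPendingDepth 3 in
lemma exists_abs_le_mul_norm_mul_norm_mul_norm (T : E →ₗ[ℝ] E →ₗ[ℝ] E →ₗ[ℝ] ℝ) :
    ∃ M, 0 ≤ M ∧ ∀ x y z, |T x y z| ≤ M * (‖x‖ * ‖y‖ * ‖z‖) := by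
  let T' : E →L[ℝ] E →L[ℝ] E →L[ℝ] ℝ := (T.compr₂
    (LinearMap.toContinuousLinearMap (𝕜 := ℝ) (E := E) (F' := ℝ)).toLinearMap)
    |>.toContinuousBilinearMap
  refine ⟨‖T'‖, norm_nonneg _, fun x y z => ?_⟩
  calc |T x y z| = ‖T' x y z‖ := by simp [T']
    _ ≤ ‖T' x y‖ * ‖z‖ := (T' x y).le_opNorm z
    _ ≤ (‖T'‖ * ‖x‖ * ‖y‖) * ‖z‖ := by gcongr; exact T'.le_opNorm₂ x y
    _ = _ := by ring

/-- Existence for a coercive problem with a nonnegative nonlinearity `c` and a skew-symmetric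
convection term `T`. Testing with the solution itself makes the convection term disappear, so that
the associated vector field points outwards on large spheres. -/
lemma exists_variational_solution (A : E →ₗ[ℝ] E →ₗ[ℝ] ℝ) (hA : ∀ x, x ≠ 0 → 0 < A x x)
    (c : E → E →ₗ[ℝ] ℝ) (hc : ∀ y, Continuous fun x => c x y) (hc0 : ∀ x, 0 ≤ c x x)
    (T : E →ₗ[ℝ] E →ₗ[ℝ] E →ₗ[ℝ] ℝ) (hT : ∀ x y, T x y y = 0) (F : E →ₗ[ℝ] ℝ) :
    ∃ x, ∀ y, A x y + c x y + T x x y = F y := by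
  obtain ⟨δ, hδ, hcoer⟩ := exists_pos_mul_norm_sq_le A hA
  obtain ⟨M, hM, hF⟩ := exists_abs_le_mul_norm F
  let Φ : E → E →L[ℝ] ℝ := fun x => (A x + c x + T x x - F).toContinuousLinearMap
  have hΦ : ∀ x y, Φ x y = A x y + c x y + T x x y - F y := fun x y => rfl
  have hΦc : Continuous Φ := by
    rw [continuous_clm_apply]
    intro y
    have h1 : Continuous fun x => A x y := (A.flip y).continuous_of_finiteDimensional
    have h2 : Continuous fun x => T x x y := by
      have : Continuous fun x =>
          (T.compr₂ (LinearMap.applyₗ y)).toContinuousBilinearMap x x := by fun_prop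
      simpa using this
    simp only [hΦ]
    exact ((h1.add (hc y)).add h2).sub continuous_const
  let G : E → E := fun x => (InnerProductSpace.toDual ℝ E).symm (Φ x)
  have hG : ∀ x y, inner ℝ (G x) y = Φ x y := fun x y => InnerProductSpace.toDual_symm_apply
  obtain ⟨x, hx⟩ := exists_zero_of_continuous_of_inner_pos (G := G) (R := M / δ + 1)
    (by positivity) ((InnerProductSpace.toDual ℝ E).symm.continuous.comp hΦc) (by
      intro x hx
      rw [hG, hΦ, hT]
      have h1 : M < δ * ‖x‖ := by
        have : M = δ * (M / δ) := by field_simp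
        nlinarith
      have h2 : 0 < ‖x‖ := by
        have : 0 ≤ M / δ := by positivity
        linarith
      nlinarith [hcoer x, hc0 x, le_of_abs_le (hF x), mul_lt_mul_of_pos_right h1 h2])
  refine ⟨x, fun y => ?_⟩
  have := hG x y
  rw [hx, inner_zero_left, hΦ] at this
  linarith

end Variational

namespace WG

noncomputable section

open MeasureTheory

/-! ### Integration over simplices -/

section Simplices

open Set

/-- The reference simplex `{y ≥ 0, ∑ yᵢ ≤ 1}` of `ℝᵈ`. -/
def refSimplex (d : ℕ) : Set (Fin d → ℝ) := {y | (∀ i, 0 ≤ y i) ∧ ∑ i, y i ≤ 1}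

lemma isClosed_refSimplex (d : ℕ) : IsClosed (refSimplex d) := by
  have : refSimplex d = (⋂ i, {y | 0 ≤ y i}) ∩ {y | ∑ i, y i ≤ 1} := by
    ext y
    simp [refSimplex]
  rw [this]
  exact (isClosed_iInter fun i => isClosed_le (by fun_prop) (by fun_prop)).inter
    (isClosed_le (by fun_prop) (by fun_prop))

lemma isCompact_refSimplex (d : ℕ) : IsCompact (refSimplex d) := by
  refine (isCompact_Icc (a := (0 : Fin d → ℝ)) (b := 1)).of_isClosed_subset
    (isClosed_refSimplex d) fun y hy => ⟨hy.1, fun i => ?_⟩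
  exact (Finset.single_le_sum (fun j _ => hy.1 j) (Finset.mem_univ i)).trans hy.2

lemma convex_refSimplex (d : ℕ) : Convex ℝ (refSimplex d) := by
  rintro y ⟨hy0, hy1⟩ z ⟨hz0, hz1⟩ a b ha hb hab
  refine ⟨fun i => ?_, ?_⟩
  · have := hy0 i
    have := hz0 i
    simp only [Pi.add_apply, Pi.smul_apply, smul_eq_mul]
    positivity
  · simp only [Pi.add_apply, Pi.smul_apply, smul_eq_mul, Finset.sum_add_distrib,
      ← Finset.mul_sum]
    nlinarith

variable {E : Type*} [NormedAddCommGroup E] [InnerProductSpace ℝ E]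

/-- The affine map sending the vertices of the reference simplex to `q 0, …, q d`. -/
def simplexMap {d : ℕ} (q : Fin (d + 1) → E) (y : Fin d → ℝ) : E :=
  q 0 + ∑ i, y i • (q i.succ - q 0)

@[fun_prop]
lemma continuous_simplexMap {d : ℕ} (q : Fin (d + 1) → E) : Continuous (simplexMap q) := by
  unfold simplexMap
  fun_prop

lemma simplexMap_image_refSimplex {d : ℕ} (q : Fin (d + 1) → E) :
    simplexMap q '' refSimplex d = convexHull ℝ (range q) := by
  apply Subset.antisymm
  · rintro _ ⟨y, ⟨hy0, hy1⟩, rfl⟩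
    have h := (convex_convexHull ℝ (range q)).sum_mem (t := Finset.univ)
      (w := Fin.cons (1 - ∑ i, y i) y) (z := q)
      (fun i _ => by
        refine Fin.cases ?_ (fun i => ?_) i
        · simpa using hy1
        · simpa using hy0 i)
      (by simp [Fin.sum_univ_succ]) (fun i _ => subset_convexHull ℝ _ ⟨i, rfl⟩)
    convert h using 1
    simp only [simplexMap, Fin.sum_univ_succ, Fin.cons_zero, Fin.cons_succ, smul_sub,
      Finset.sum_sub_distrib, ← Finset.sum_smul, sub_smul, one_smul]
    abel
  · refine convexHull_min ?_ ?_
    · rintro _ ⟨i, rfl⟩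
      refine Fin.cases ⟨0, ?_, ?_⟩ (fun i => ⟨Pi.single i 1, ?_, ?_⟩) i
      · simp [refSimplex]
      · simp [simplexMap]
      · refine ⟨fun j => ?_, by simp⟩
        by_cases h : j = i
        · subst h; simp
        · simp [h]
      · simp [simplexMap, Pi.single_apply, ite_smul]
    · rintro _ ⟨y, hy, rfl⟩ _ ⟨z, hz, rfl⟩ a b ha hb hab
      refine ⟨a • y + b • z, convex_refSimplex d hy hz ha hb hab, ?_⟩
      simp only [simplexMap, Pi.add_apply, Pi.smul_apply, smul_eq_mul, add_smul,
        Finset.sum_add_distrib, smul_add, Finset.smul_sum, mul_smul]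
      rw [add_add_add_comm, ← add_smul, hab, one_smul]

variable [MeasurableSpace E] [BorelSpace E]

/-- Integrals over a nondegenerate `d`-simplex, with respect to `d`-dimensional Hausdorff measure,
are proportional to integrals over the reference simplex. -/
lemma exists_integral_convexHull_eq {d : ℕ} {q : Fin (d + 1) → E} (hq : AffineIndependent ℝ q) :
    ∃ c : ℝ, c ≠ 0 ∧ ∀ g : E → ℝ,
      ∫ x in convexHull ℝ (range q), g x ∂(Measure.euclideanHausdorffMeasure d)
        = c * ∫ y in refSimplex d, g (simplexMap q y) := by
  let L : EuclideanSpace ℝ (Fin d) →ₗ[ℝ] E :=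
    Fintype.linearCombination ℝ (fun i : Fin d => q i.succ - q 0) ∘ₗ
      (WithLp.linearEquiv 2 ℝ (Fin d → ℝ)).toLinearMap
  have hL : ∀ y : EuclideanSpace ℝ (Fin d), L y = ∑ i, y i • (q i.succ - q 0) := fun y => by
    simp [L, Fintype.linearCombination_apply]
  have hlin : LinearIndependent ℝ fun i : Fin d => q i.succ - q 0 := by
    have h := (affineIndependent_iff_linearIndependent_vsub ℝ q 0).1 hq
    exact h.comp (fun i : Fin d => (⟨i.succ, Fin.succ_ne_zero i⟩ : {x : Fin (d + 1) // x ≠ 0}))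
      fun i j hij => by simpa using hij
  have hinj : Function.Injective L := by
    rw [injective_iff_map_eq_zero]
    intro y hy
    rw [hL] at hy
    ext i
    exact Fintype.linearIndependent_iff.1 hlin _ hy i
  have hdet : L.normDet ≠ 0 := ((L.normDet_ne_zero_tfae).out 0 4).2 hinj
  have hmap : ∀ y, simplexMap q y = q 0 + L (WithLp.toLp 2 y) := fun y => by
    simp [simplexMap, hL]
  have hφ : Function.Injective (simplexMap q) := by
    intro y z h
    rw [hmap, hmap, add_right_inj] at h
    simpa using hinj h
  have hemb : MeasurableEmbedding (simplexMap q) :=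
    (continuous_simplexMap q).measurableEmbedding hφ
  have hcomap : (Measure.euclideanHausdorffMeasure d : Measure E).comap (simplexMap q)
      = ENNReal.ofReal L.normDet • (volume : Measure (Fin d → ℝ)) := by
    ext s hs
    have himg : simplexMap q '' s
        = (IsometryEquiv.vaddConst (q 0)) '' (L '' (WithLp.toLp 2 '' s)) := by
      rw [image_image, image_image]
      refine image_congr fun y _ => ?_
      rw [hmap, add_comm]
      rfl
    have hvol : volume (WithLp.toLp 2 '' s : Set (EuclideanSpace ℝ (Fin d))) = volume s := by
      rw [← (PiLp.volume_preserving_toLp (Fin d)).measure_preimage_emb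
        (MeasurableEquiv.toLp 2 (Fin d → ℝ)).measurableEmbedding,
        preimage_image_eq _ (WithLp.toLp_injective 2)]
    have hLm := L.euclideanHausdorffMeasure_image_eq_normDet_mul_volume (WithLp.toLp 2 '' s)
    rw [finrank_euclideanSpace_fin, hvol] at hLm
    rw [hemb.comap_apply, himg, (IsometryEquiv.isometry _).euclideanHausdorffMeasure_image, hLm,
      Measure.smul_apply, smul_eq_mul]
  refine ⟨L.normDet, hdet, fun g => ?_⟩
  have h1 := hemb.setIntegral_map (μ := (Measure.euclideanHausdorffMeasure d : Measure E).comap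
    (simplexMap q)) g (simplexMap q '' refSimplex d)
  rw [hemb.map_comap, Measure.restrict_restrict
    (hemb.measurableSet_image.2 (isClosed_refSimplex d).measurableSet),
    inter_eq_left.2 (image_subset_range _ _), preimage_image_eq _ hφ, hcomap,
    Measure.restrict_smul, integral_smul_measure, simplexMap_image_refSimplex] at h1
  rw [h1, ENNReal.toReal_ofReal L.normDet_nonneg, smul_eq_mul]

lemma insertNth_mem_refSimplex {d : ℕ} (j : Fin (d + 1)) (s : ℝ) (z : Fin d → ℝ) :
    j.insertNth s z ∈ refSimplex (d + 1) ↔ z ∈ refSimplex d ∧ s ∈ Icc 0 (1 - ∑ i, z i) := by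
  simp only [refSimplex, mem_ofPred_eq, Fin.forall_iff_succAbove j, Fin.insertNth_apply_same,
    Fin.insertNth_apply_succAbove, Fin.sum_univ_succAbove _ j, mem_Icc]
  constructor
  · rintro ⟨⟨h1, h2⟩, h3⟩
    exact ⟨⟨h2, by linarith⟩, h1, by linarith⟩
  · rintro ⟨⟨h1, h2⟩, h3, h4⟩
    exact ⟨⟨h3, h1⟩, by linarith⟩

/-- Fubini on the reference simplex. -/
lemma integral_refSimplex_succ {d : ℕ} (j : Fin (d + 1)) {f : (Fin (d + 1) → ℝ) → ℝ}
    (hf : Continuous f) :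
    ∫ y in refSimplex (d + 1), f y
      = ∫ z in refSimplex d, ∫ s in (0 : ℝ)..(1 - ∑ i, z i), f (j.insertNth s z) := by
  let e := (MeasurableEquiv.piFinSuccAbove (fun _ : Fin (d + 1) => ℝ) j).symm
  have he : ∀ p : ℝ × (Fin d → ℝ), e p = j.insertNth p.1 p.2 := fun p => rfl
  have hmp : MeasurePreserving e (volume.prod volume) volume :=
    (volume_preserving_piFinSuccAbove (fun _ : Fin (d + 1) => ℝ) j).symm _
  have hm := (isClosed_refSimplex (d + 1)).measurableSet
  have hint : Integrable ((refSimplex (d + 1)).indicator f) :=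
    (hf.continuousOn.integrableOn_compact (isCompact_refSimplex _)).integrable_indicator hm
  rw [← integral_indicator hm, ← hmp.integral_comp e.measurableEmbedding, integral_prod_symm
      (fun p => (refSimplex (d + 1)).indicator f (e p))
    (hmp.integrable_comp_emb e.measurableEmbedding |>.2 hint),
    ← integral_indicator (isClosed_refSimplex d).measurableSet]
  refine integral_congr_ae (.of_forall fun z => ?_)
  by_cases hz : z ∈ refSimplex d
  · have hz1 : 0 ≤ 1 - ∑ i, z i := by linarith [hz.2]
    simp only [indicator_of_mem hz]
    rw [intervalIntegral.integral_of_le hz1, ← integral_Icc_eq_integral_Ioc,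
      ← integral_indicator measurableSet_Icc]
    refine integral_congr_ae (.of_forall fun s => ?_)
    simp only [he, indicator, insertNth_mem_refSimplex, hz, true_and]
  · simp only [indicator_of_notMem hz, he]
    refine (integral_congr_ae (.of_forall fun s => ?_)).trans (integral_zero _ _)
    simp [indicator, insertNth_mem_refSimplex, hz]

end Simplices

/-! ### A weak form of Green's formula -/

section Green

open Set

lemma hasDerivAt_val {n : ℕ} (p : Poly n) (x w : EuclideanSpace ℝ (Fin n)) (s : ℝ) :
    HasDerivAt (fun s : ℝ => val p (x + s • w))
      (∑ l, w l * val (MvPolynomial.pderiv l p) (x + s • w)) s := by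
  induction p using MvPolynomial.induction_on with
  | C a =>
    simpa [val] using hasDerivAt_const s a
  | add p q hp hq =>
    simp only [map_add, val_add, mul_add, Finset.sum_add_distrib]
    exact hp.add hq
  | mul_X p i hp =>
    have hX : HasDerivAt (fun s : ℝ => x i + s * w i) (w i) s := by
      simpa using ((hasDerivAt_id s).mul_const (w i)).const_add (x i)
    have h := hp.mul hX
    have hval : (fun s : ℝ => val (p * MvPolynomial.X i) (x + s • w))
        = (fun s => val p (x + s • w)) * fun s => x i + s * w i := by
      ext s
      simp [val]
    rw [hval]
    refine h.congr_deriv ?_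
    simp only [val, map_mul, MvPolynomial.eval_X, Derivation.leibniz, map_add, smul_eq_mul,
      MvPolynomial.pderiv_X, PiLp.add_apply, PiLp.smul_apply]
    simp only [mul_add, add_mul, Finset.sum_add_distrib, Finset.sum_mul, Pi.single_apply,
      apply_ite (MvPolynomial.eval _), map_one, map_zero, mul_ite, mul_one, mul_zero,
      Finset.sum_ite_eq, Finset.mem_univ, if_true]
    rw [add_comm, mul_comm (w i)]
    congr 2 <;> exact Finset.sum_congr rfl fun l _ => by ring

/-- Integrals over a face, parametrised by any enumeration of its vertices. -/
lemma exists_integral_face_eq {d : ℕ} (K : Element (d + 1)) (i : Fin (d + 2))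
    (σ : Fin (d + 1) → Fin (d + 2)) (hσ : Function.Injective σ) (hi : range σ = {i}ᶜ) :
    ∃ c : ℝ, c ≠ 0 ∧ ∀ g : EuclideanSpace ℝ (Fin (d + 1)) → ℝ,
      ∫ x, g x ∂(faceMeasure K i)
        = c * ∫ y in refSimplex d, g (simplexMap (fun k => K.points (σ k)) y) := by
  have hface : face K i = convexHull ℝ (range fun k => K.points (σ k)) := by
    rw [face, ← Affine.Simplex.convexHull_eq_closedInterior,
      Affine.Simplex.range_faceOpposite_points, ← hi, ← range_comp]
    rfl
  have h := exists_integral_convexHull_eq (K.independent.comp_embedding ⟨σ, hσ⟩)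
  rw [faceMeasure, hface]
  exact h

lemma exists_integral_element_eq {n : ℕ} (K : Element n) :
    ∃ c : ℝ, c ≠ 0 ∧ ∀ g : EuclideanSpace ℝ (Fin n) → ℝ,
      ∫ x in K.closedInterior, g x = c * ∫ y in refSimplex n, g (simplexMap K.points y) := by
  have h := exists_integral_convexHull_eq K.independent
  rwa [EuclideanSpace.euclideanHausdorffMeasure_eq_volume,
    Affine.Simplex.convexHull_eq_closedInterior] at h

/-- The integral over `K` of the derivative of `g` along the edge from the vertex `0` to the vertex
`j + 1` vanishes if the integrals of `g` over the two faces opposite to these vertices do: the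
segments of `K` parallel to the edge run from one of these faces to the other. -/
lemma sum_integral_pderiv_edge_eq_zero {d : ℕ} (K : Element (d + 1)) (g : Poly (d + 1))
    (hg : ∀ i, ∫ x, val g x ∂(faceMeasure K i) = 0) (j : Fin (d + 1)) :
    ∑ l, (K.points j.succ - K.points 0) l *
      ∫ x in K.closedInterior, val (MvPolynomial.pderiv l g) x = 0 := by
  set w := K.points j.succ - K.points 0 with hw
  obtain ⟨c, -, hc⟩ := exists_integral_element_eq K
  -- Vertices of the face opposite to `j + 1`, then those of the face opposite to `0`.
  let σ : Fin (d + 1) → Fin (d + 2) := j.succ.succAbove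
  let ρ : Fin (d + 1) → Fin (d + 2) := fun k => (Fin.cons j j.succAbove : Fin (d + 1) → _) k |>.succ
  have hσinj : Function.Injective σ := Fin.succAbove_right_injective
  have hρinj : Function.Injective ρ := by
    refine (Fin.succ_injective _).comp ?_
    rw [Fin.cons_injective_iff]
    exact ⟨by simp, Fin.succAbove_right_injective⟩
  have hρ : range ρ = {0}ᶜ := by
    have : range (Fin.cons j j.succAbove : Fin (d + 1) → Fin (d + 1)) = univ := by
      rw [Fin.range_cons, Fin.range_succAbove]
      ext k
      simp [em]
    ext k
    refine Fin.cases ?_ (fun k => ?_) k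
    · simp [ρ, Fin.succ_ne_zero]
    · have hk : k ∈ range (Fin.cons j j.succAbove : Fin (d + 1) → Fin (d + 1)) := by
        rw [this]; trivial
      obtain ⟨i, hi⟩ := hk
      simp only [mem_compl_iff, mem_singleton_iff, Fin.succ_ne_zero, not_false_eq_true, iff_true]
      exact ⟨i, by simp [ρ, hi]⟩
  obtain ⟨c₁, hc₁, h₁⟩ := exists_integral_face_eq K _ σ hσinj (Fin.range_succAbove _)
  obtain ⟨c₂, hc₂, h₂⟩ := exists_integral_face_eq K _ ρ hρinj hρ
  have hI₁ : ∫ y in refSimplex d, val g (simplexMap (fun k => K.points (σ k)) y) = 0 :=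
    (mul_eq_zero.1 ((h₁ (val g)).symm.trans (hg _))).resolve_left hc₁
  have hI₂ : ∫ y in refSimplex d, val g (simplexMap (fun k => K.points (ρ k)) y) = 0 :=
    (mul_eq_zero.1 ((h₂ (val g)).symm.trans (hg _))).resolve_left hc₂
  have hins : ∀ (s : ℝ) (z : Fin d → ℝ), simplexMap K.points (j.insertNth s z)
      = simplexMap (fun k => K.points (σ k)) z + s • w := by
    intro s z
    simp only [simplexMap, Fin.sum_univ_succAbove _ j, Fin.insertNth_apply_same,
      Fin.insertNth_apply_succAbove, σ, Fin.succ_succAbove_zero, Fin.succ_succAbove_succ, hw]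
    abel
  have hend : ∀ z : Fin d → ℝ,
      simplexMap (fun k => K.points (σ k)) z + (1 - ∑ i, z i) • w
        = simplexMap (fun k => K.points (ρ k)) z := by
    intro z
    simp only [simplexMap, σ, ρ, Fin.succ_succAbove_zero, Fin.succ_succAbove_succ, hw,
      Fin.cons_zero, Fin.cons_succ, smul_sub, sub_smul, one_smul, Finset.sum_sub_distrib,
      ← Finset.sum_smul]
    abel
  let D : EuclideanSpace ℝ (Fin (d + 1)) → ℝ :=
    fun x => ∑ l, w l * val (MvPolynomial.pderiv l g) x
  have hD : Continuous D :=
    continuous_finsetSum _ fun l _ => continuous_const.mul (continuous_val _)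
  have hDK : ∑ l, w l * ∫ x in K.closedInterior, val (MvPolynomial.pderiv l g) x
      = ∫ x in K.closedInterior, D x := by
    rw [integral_finsetSum _ fun l _ =>
      (((continuous_val _).continuousOn.integrableOn_compact (isCompact_element K)).const_mul _)]
    simp only [integral_const_mul]
  rw [hDK, hc, integral_refSimplex_succ j
      (f := fun y => D (simplexMap K.points y)) (hD.comp (continuous_simplexMap _))]
  have hFTC : ∀ z : Fin d → ℝ, ∫ s in (0 : ℝ)..(1 - ∑ i, z i),
      D (simplexMap K.points (j.insertNth s z))
        = val g (simplexMap (fun k => K.points (ρ k)) z)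
          - val g (simplexMap (fun k => K.points (σ k)) z) := by
    intro z
    simp only [hins]
    rw [intervalIntegral.integral_eq_sub_of_hasDerivAt
      (fun s _ => hasDerivAt_val g (simplexMap (fun k => K.points (σ k)) z) w s)
      ((hD.comp (by fun_prop)).intervalIntegrable _ _), hend]
    simp
  simp only [hFTC]
  have hcont : ∀ q : Fin (d + 1) → EuclideanSpace ℝ (Fin (d + 1)),
      IntegrableOn (fun z => val g (simplexMap q z)) (refSimplex d) := fun q =>
    ((continuous_val g).comp (continuous_simplexMap q)).continuousOn.integrableOn_compact
      (isCompact_refSimplex d)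
  rw [integral_sub (hcont _) (hcont _), hI₁, hI₂, sub_zero, mul_zero]

/-- A consequence of Green's formula on `K` which needs neither the normals nor the measures of
the faces. -/
lemma integral_pderiv_eq_zero {n : ℕ} [NeZero n] (K : Element n) (g : Poly n)
    (hg : ∀ i, ∫ x, val g x ∂(faceMeasure K i) = 0) (l : Fin n) :
    ∫ x in K.closedInterior, val (MvPolynomial.pderiv l g) x = 0 := by
  obtain ⟨d, rfl⟩ := Nat.exists_eq_succ_of_ne_zero (NeZero.ne n)
  let I : EuclideanSpace ℝ (Fin (d + 1)) :=
    WithLp.toLp 2 fun l => ∫ x in K.closedInterior, val (MvPolynomial.pderiv l g) x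
  have hperp : ∀ j : Fin (d + 1), inner ℝ (K.points j.succ - K.points 0) I = 0 := by
    intro j
    rw [← sum_integral_pderiv_edge_eq_zero K g hg j, PiLp.inner_apply]
    simp [I, mul_comm]
  have hlin : LinearIndependent ℝ fun i : Fin (d + 1) => K.points i.succ - K.points 0 := by
    have h := (affineIndependent_iff_linearIndependent_vsub ℝ K.points 0).1 K.independent
    exact h.comp (fun i : Fin (d + 1) => (⟨i.succ, Fin.succ_ne_zero i⟩ :
      {x : Fin (d + 2) // x ≠ 0})) fun i j hij => by simpa using hij
  have hspan := hlin.span_eq_top_of_card_eq_finrank' (by simp)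
  have hI : I = 0 := by
    have hmem : I ∈ Submodule.span ℝ
        (range fun i : Fin (d + 1) => K.points i.succ - K.points 0) := by
      rw [hspan]; trivial
    rw [← inner_self_eq_zero (𝕜 := ℝ)]
    refine Submodule.span_induction (p := fun x _ => inner ℝ x I = 0) ?_ (inner_zero_left _) ?_ ?_
      hmem
    · rintro _ ⟨j, rfl⟩
      exact hperp j
    · intro x y _ _ hx hy
      rw [inner_add_left, hx, hy, add_zero]
    · intro a x _ hx
      rw [real_inner_smul_left, hx, mul_zero]
  exact congrArg (fun v : EuclideanSpace ℝ (Fin (d + 1)) => v l) hI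

end Green

/-! ### Linearity of the forms -/

section Linearity

variable {n : ℕ} (K : Element n)

lemma innerK_add_left (p q r : Poly n) : innerK K (p + q) r = innerK K p r + innerK K q r := by
  simp only [innerK_comm K _ r, innerK_add_right]

lemma innerK_smul_left (c : ℝ) (p q : Poly n) : innerK K (c • p) q = c * innerK K p q := by
  simp only [innerK_comm K _ q, innerK_smul_right]

lemma innerK_sub_left (p q r : Poly n) : innerK K (p - q) r = innerK K p r - innerK K q r := by
  rw [sub_eq_add_neg, ← neg_one_smul ℝ q, innerK_add_left, innerK_smul_left]
  ring

lemma innerK_zero_right (p : Poly n) : innerK K p 0 = 0 := by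
  rw [← zero_smul ℝ (0 : Poly n), innerK_smul_right, zero_mul]

lemma innerK_self_nonneg (p : Poly n) : 0 ≤ innerK K p p :=
  integral_nonneg fun _ => mul_self_nonneg _

lemma vecInnerK_add_left (u v w : Fin n → Poly n) :
    vecInnerK K (u + v) w = vecInnerK K u w + vecInnerK K v w := by
  simp [vecInnerK, innerK_add_left, Finset.sum_add_distrib]

lemma vecInnerK_add_right (u v w : Fin n → Poly n) :
    vecInnerK K u (v + w) = vecInnerK K u v + vecInnerK K u w := by
  simp [vecInnerK, innerK_add_right, Finset.sum_add_distrib]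

lemma vecInnerK_smul_left (c : ℝ) (u v : Fin n → Poly n) :
    vecInnerK K (c • u) v = c * vecInnerK K u v := by
  simp [vecInnerK, innerK_smul_left, Finset.mul_sum]

lemma vecInnerK_smul_right (c : ℝ) (u v : Fin n → Poly n) :
    vecInnerK K u (c • v) = c * vecInnerK K u v := by
  simp [vecInnerK, innerK_smul_right, Finset.mul_sum]

lemma matInnerK_add_left (A B C : Fin n → Fin n → Poly n) :
    matInnerK K (A + B) C = matInnerK K A C + matInnerK K B C := by
  simp [matInnerK, vecInnerK_add_left, Finset.sum_add_distrib]

lemma matInnerK_add_right (A B C : Fin n → Fin n → Poly n) :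
    matInnerK K A (B + C) = matInnerK K A B + matInnerK K A C := by
  simp [matInnerK, vecInnerK_add_right, Finset.sum_add_distrib]

lemma matInnerK_smul_left (c : ℝ) (A B : Fin n → Fin n → Poly n) :
    matInnerK K (c • A) B = c * matInnerK K A B := by
  simp [matInnerK, vecInnerK_smul_left, Finset.mul_sum]

lemma matInnerK_smul_right (c : ℝ) (A B : Fin n → Fin n → Poly n) :
    matInnerK K A (c • B) = c * matInnerK K A B := by
  simp [matInnerK, vecInnerK_smul_right, Finset.mul_sum]

lemma vecInnerK_self_nonneg (u : Fin n → Poly n) : 0 ≤ vecInnerK K u u :=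
  Finset.sum_nonneg fun _ _ => innerK_self_nonneg K _

lemma matInnerK_self_nonneg (A : Fin n → Fin n → Poly n) : 0 ≤ matInnerK K A A :=
  Finset.sum_nonneg fun _ _ => vecInnerK_self_nonneg K _

lemma eq_zero_of_matInnerK_self (A : Fin n → Fin n → Poly n) (h : matInnerK K A A = 0) :
    A = 0 := by
  funext l j
  have h1 := (Finset.sum_eq_zero_iff_of_nonneg fun l _ => vecInnerK_self_nonneg K (A l)).1 h l
    (Finset.mem_univ l)
  exact eq_zero_of_innerK_self K _ ((Finset.sum_eq_zero_iff_of_nonneg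
    fun j _ => innerK_self_nonneg K (A l j)).1 h1 j (Finset.mem_univ j))

lemma div_add (u v : Fin n → Poly n) : div (u + v) = div u + div v := by
  simp [div, Finset.sum_add_distrib]

lemma div_smul (c : ℝ) (u : Fin n → Poly n) : div (c • u) = c • div u := by
  simp [div, Finset.smul_sum]

/-- The bilinear form `-(q, ∇·v)_K`, which is `b_{h,K}(v, q)` for `v ∈ [P_m(K)]ⁿ`. -/
def bForm : (Fin n → Poly n) →ₗ[ℝ] Poly n →ₗ[ℝ] ℝ :=
  LinearMap.mk₂ ℝ (fun v q => -innerK K q (div v))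
    (fun u v q => by simp only [div_add, innerK_add_right]; ring)
    (fun c u q => by simp only [div_smul, innerK_smul_right, smul_eq_mul]; ring)
    (fun u p q => by simp only [innerK_add_left]; ring)
    (fun c u q => by simp only [innerK_smul_left, smul_eq_mul]; ring)

variable [NeZero n]

lemma bdryNormal_zero (ς : Fin n → Poly n) : bdryNormal K 0 ς = 0 := by
  simp [bdryNormal, innerFace, val]

lemma bdryFlux_zero (ς : Poly n) : bdryFlux K 0 ς = 0 := by
  simp [bdryFlux, innerFace, val]

lemma sum_innerK_weakGrad {γ : ℕ} (p : Poly n) {ς : Fin n → Poly n} (hς : ς ∈ VecP n γ) :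
    vecInnerK K (weakGrad K γ p 0) ς = -innerK K p (div ς) := by
  rw [vecInnerK, (weakGrad_spec K γ p 0).2 ς hς, bdryNormal_zero, add_zero]

lemma innerK_weakDiv {γ : ℕ} (w : Fin n → Poly n) {ς : Poly n} (hς : ς ∈ P n γ) :
    innerK K (weakDiv K γ w 0) ς = -∑ j, innerK K (w j) (MvPolynomial.pderiv j ς) := by
  rw [(weakDiv_spec K γ w 0).2 ς hς, bdryFlux_zero, add_zero]

lemma weakGrad_add (γ : ℕ) (p q : Poly n) :
    weakGrad K γ (p + q) 0 = weakGrad K γ p 0 + weakGrad K γ q 0 := by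
  refine (weakGrad_spec K γ (p + q) 0).unique
    ⟨add_mem (weakGrad_spec K γ p 0).1 (weakGrad_spec K γ q 0).1, fun ς hς => ?_⟩
  have := vecInnerK_add_left K (weakGrad K γ p 0) (weakGrad K γ q 0) ς
  rw [sum_innerK_weakGrad K p hς, sum_innerK_weakGrad K q hς] at this
  rw [bdryNormal_zero, innerK_add_left, add_zero, neg_add, ← this, vecInnerK]

lemma weakGrad_smul (γ : ℕ) (c : ℝ) (p : Poly n) :
    weakGrad K γ (c • p) 0 = c • weakGrad K γ p 0 := by
  refine (weakGrad_spec K γ (c • p) 0).unique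
    ⟨Submodule.smul_mem _ c (weakGrad_spec K γ p 0).1, fun ς hς => ?_⟩
  have := vecInnerK_smul_left K c (weakGrad K γ p 0) ς
  rw [sum_innerK_weakGrad K p hς] at this
  rw [bdryNormal_zero, innerK_smul_left, add_zero, ← mul_neg, ← this, vecInnerK]

lemma vecWeakGrad_add (γ : ℕ) (u v : Fin n → Poly n) :
    vecWeakGrad K γ (u + v) 0 = vecWeakGrad K γ u 0 + vecWeakGrad K γ v 0 :=
  funext fun l => weakGrad_add K γ (u l) (v l)

lemma vecWeakGrad_smul (γ : ℕ) (c : ℝ) (u : Fin n → Poly n) :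
    vecWeakGrad K γ (c • u) 0 = c • vecWeakGrad K γ u 0 :=
  funext fun l => weakGrad_smul K γ c (u l)

lemma faceProj_add (k : ℕ) (i : Fin (n + 1)) (p q : Poly n) :
    faceProj K k i (p + q) = faceProj K k i p + faceProj K k i q := by
  simp [faceProj]

lemma faceProj_smul (k : ℕ) (i : Fin (n + 1)) (c : ℝ) (p : Poly n) :
    faceProj K k i (c • p) = c • faceProj K k i p := by
  simp [faceProj]

/-- The bilinear form `a_{h,K}`. -/
def aForm (m k : ℕ) (ν : ℝ) : (Fin n → Poly n) →ₗ[ℝ] (Fin n → Poly n) →ₗ[ℝ] ℝ :=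
  LinearMap.mk₂ ℝ (aK K m k ν)
    (fun u v w => by
      simp only [aK, stab, vecWeakGrad_add, matInnerK_add_left, Pi.add_apply, faceProj_add,
        inner_add_left, mul_add, Finset.sum_add_distrib]
      ring)
    (fun c u v => by
      simp only [aK, stab, vecWeakGrad_smul, matInnerK_smul_left, Pi.smul_apply, faceProj_smul,
        real_inner_smul_left, Finset.mul_sum, smul_eq_mul, mul_add]
      congr 1
      · ring
      · exact Finset.sum_congr rfl fun i _ => Finset.sum_congr rfl fun j _ => by ring)
    (fun u v w => by
      simp only [aK, stab, vecWeakGrad_add, matInnerK_add_right, Pi.add_apply, faceProj_add,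
        inner_add_right, mul_add, Finset.sum_add_distrib]
      ring)
    (fun c u v => by
      simp only [aK, stab, vecWeakGrad_smul, matInnerK_smul_right, Pi.smul_apply, faceProj_smul,
        real_inner_smul_right, Finset.mul_sum, smul_eq_mul, mul_add]
      congr 1
      · ring
      · exact Finset.sum_congr rfl fun i _ => Finset.sum_congr rfl fun j _ => by ring)

lemma bK_eq {m : ℕ} {v : Fin n → Poly n} (hv : v ∈ VecP n m) (q : Poly n) :
    bK K m v q = -innerK K q (div v) :=
  sum_innerK_weakGrad K q hv

end Linearity

/-! ### Convection, Forchheimer and load terms -/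

section Forms

variable {n : ℕ} (K : Element n)

/-- The functional `v ↦ d_{h,K}(κ; u, v)`, with the weak divergences eliminated by their
definition. -/
def dFunctional (κ u : Fin n → Poly n) : (Fin n → Poly n) →ₗ[ℝ] ℝ where
  toFun v := 1 / 2 * ∑ l, ∑ j, (innerK K (v l * κ j) (MvPolynomial.pderiv j (u l))
    - innerK K (u l * κ j) (MvPolynomial.pderiv j (v l)))
  map_add' v w := by
    simp only [Pi.add_apply, add_mul, map_add, innerK_add_left, innerK_add_right, ← mul_add,
      ← Finset.sum_add_distrib]
    congr 1
    exact Finset.sum_congr rfl fun l _ => Finset.sum_congr rfl fun j _ => by ring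
  map_smul' c v := by
    simp only [Pi.smul_apply, smul_mul_assoc, Derivation.map_smul, innerK_smul_left,
      innerK_smul_right, ← mul_sub, ← Finset.mul_sum, RingHom.id_apply, smul_eq_mul]
    ring

/-- The trilinear form which agrees with `d_{h,K}` on `[P_m(K)]ⁿ`. -/
def dForm : (Fin n → Poly n) →ₗ[ℝ] (Fin n → Poly n) →ₗ[ℝ] (Fin n → Poly n) →ₗ[ℝ] ℝ :=
  LinearMap.mk₂ ℝ (dFunctional K)
    (fun κ κ' u => LinearMap.ext fun v => by
      simp only [dFunctional, LinearMap.coe_mk, AddHom.coe_mk, LinearMap.add_apply, Pi.add_apply,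
        mul_add, innerK_add_left]
      rw [← mul_add]
      simp only [← Finset.sum_add_distrib]
      congr 1
      exact Finset.sum_congr rfl fun l _ => Finset.sum_congr rfl fun j _ => by ring)
    (fun c κ u => LinearMap.ext fun v => by
      simp only [dFunctional, LinearMap.coe_mk, AddHom.coe_mk, LinearMap.smul_apply,
        Pi.smul_apply, mul_smul_comm, innerK_smul_left, ← mul_sub, ← Finset.mul_sum, smul_eq_mul]
      ring)
    (fun κ u u' => LinearMap.ext fun v => by
      simp only [dFunctional, LinearMap.coe_mk, AddHom.coe_mk, LinearMap.add_apply, Pi.add_apply,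
        add_mul, map_add, innerK_add_left, innerK_add_right, ← mul_add, ← Finset.sum_add_distrib]
      congr 1
      exact Finset.sum_congr rfl fun l _ => Finset.sum_congr rfl fun j _ => by ring)
    (fun c κ u => LinearMap.ext fun v => by
      simp only [dFunctional, LinearMap.coe_mk, AddHom.coe_mk, LinearMap.smul_apply,
        Pi.smul_apply, smul_mul_assoc, Derivation.map_smul, innerK_smul_left, innerK_smul_right,
        ← mul_sub, ← Finset.mul_sum, smul_eq_mul]
      ring)

lemma dForm_self (κ u : Fin n → Poly n) : dForm K κ u u = 0 := by
  simp [dForm, dFunctional]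

lemma dK_eq [NeZero n] {m : ℕ} (κ : Fin n → Poly n) {u v : Fin n → Poly n}
    (hu : u ∈ VecP n m) (hv : v ∈ VecP n m) : dK K m κ u v = dForm K κ u v := by
  have key : ∀ u v : Fin n → Poly n, v ∈ VecP n m →
      vecInnerK K (matWeakDiv K m (tensor u κ) 0) v
        = -∑ l, ∑ j, innerK K (u l * κ j) (MvPolynomial.pderiv j (v l)) := by
    intro u v hv
    have h : ∀ l, innerK K (matWeakDiv K m (tensor u κ) 0 l) (v l)
        = -∑ j, innerK K (u l * κ j) (MvPolynomial.pderiv j (v l)) := fun l =>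
      innerK_weakDiv K (tensor u κ l) (hv l (Set.mem_univ l))
    simp only [vecInnerK, h, Finset.sum_neg_distrib]
  rw [dK, key u v hv, key v u hu]
  simp only [dForm, dFunctional, LinearMap.mk₂_apply, LinearMap.coe_mk, AddHom.coe_mk,
    Finset.sum_sub_distrib]
  ring

lemma continuous_vecVal (v : Fin n → Poly n) : Continuous (vecVal v) :=
  (PiLp.continuous_toLp 2 _).comp (continuous_pi fun j => continuous_val (v j))

lemma vecVal_add (u v : Fin n → Poly n) (x : EuclideanSpace ℝ (Fin n)) :
    vecVal (u + v) x = vecVal u x + vecVal v x := by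
  ext j
  simp [vecVal, val_add]

lemma vecVal_smul (c : ℝ) (v : Fin n → Poly n) (x : EuclideanSpace ℝ (Fin n)) :
    vecVal (c • v) x = c • vecVal v x := by
  ext j
  simp [vecVal, val_smul]

lemma vecVal_sub (u v : Fin n → Poly n) (x : EuclideanSpace ℝ (Fin n)) :
    vecVal (u - v) x = vecVal u x - vecVal v x := by
  rw [sub_eq_add_neg, ← neg_one_smul ℝ v, vecVal_add, vecVal_smul, neg_one_smul, sub_eq_add_neg]

lemma integrableOn_cK {r : ℝ} (hr : 2 ≤ r) (α : ℝ) (κ u v : Fin n → Poly n) :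
    IntegrableOn (fun x => α * ‖vecVal κ x‖ ^ (r - 2) * inner ℝ (vecVal u x) (vecVal v x))
      K.closedInterior := by
  refine Continuous.continuousOn ?_ |>.integrableOn_compact (isCompact_element K)
  exact (continuous_const.mul ((continuous_vecVal κ).norm.rpow_const
    fun _ => Or.inr (by linarith))).mul ((continuous_vecVal u).inner (continuous_vecVal v))

/-- The functional `v ↦ c_{h,K}(κ; u, v)`. -/
def cForm {r : ℝ} (hr : 2 ≤ r) (α : ℝ) (κ u : Fin n → Poly n) : (Fin n → Poly n) →ₗ[ℝ] ℝ where
  toFun v := cK K α r κ u v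
  map_add' v w := by
    simp only [cK, vecVal_add, inner_add_right, mul_add]
    exact integral_add (integrableOn_cK K hr α κ u v) (integrableOn_cK K hr α κ u w)
  map_smul' c v := by
    simp only [cK, vecVal_smul, real_inner_smul_right, RingHom.id_apply, smul_eq_mul,
      ← integral_const_mul]
    congr 1
    ext x
    ring

lemma cK_self_nonneg {α : ℝ} (hα : 0 ≤ α) (r : ℝ) (u : Fin n → Poly n) :
    0 ≤ cK K α r u u u :=
  integral_nonneg fun x => by
    have : 0 ≤ inner ℝ (vecVal u x) (vecVal u x) := real_inner_self_nonneg
    positivity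

/-- Monotonicity of `a ↦ |a|^s a`. -/
lemma inner_norm_rpow_smul_sub_nonneg {V : Type*} [NormedAddCommGroup V] [InnerProductSpace ℝ V]
    {s : ℝ} (hs : 0 ≤ s) (a b : V) :
    0 ≤ ‖a‖ ^ s * inner ℝ a (a - b) - ‖b‖ ^ s * inner ℝ b (a - b) := by
  have hA : 0 ≤ ‖a‖ ^ s := by positivity
  have hB : 0 ≤ ‖b‖ ^ s := by positivity
  have hab := real_inner_le_norm a b
  have hmono : 0 ≤ (‖a‖ ^ s * ‖a‖ - ‖b‖ ^ s * ‖b‖) * (‖a‖ - ‖b‖) := by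
    rcases le_total ‖a‖ ‖b‖ with h | h
    · refine mul_nonneg_of_nonpos_of_nonpos (sub_nonpos.2 ?_) (sub_nonpos.2 h)
      gcongr
    · refine mul_nonneg (sub_nonneg.2 ?_) (sub_nonneg.2 h)
      gcongr
  rw [inner_sub_right, inner_sub_right, real_inner_self_eq_norm_sq, real_inner_self_eq_norm_sq,
    real_inner_comm a b]
  nlinarith [mul_le_mul_of_nonneg_left hab (add_nonneg hA hB)]

lemma cK_sub_nonneg {r : ℝ} (hr : 2 ≤ r) {α : ℝ} (hα : 0 ≤ α) (u v : Fin n → Poly n) :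
    0 ≤ cK K α r u u (u - v) - cK K α r v v (u - v) := by
  rw [cK, cK, ← integral_sub (integrableOn_cK K hr α u u (u - v))
    (integrableOn_cK K hr α v v (u - v))]
  refine integral_nonneg fun x => ?_
  have h := mul_nonneg hα (inner_norm_rpow_smul_sub_nonneg (sub_nonneg.2 hr) (vecVal u x)
    (vecVal v x))
  rw [← vecVal_sub] at h
  simp only [Pi.zero_apply]
  linarith

lemma continuous_uncurry_val {E : Type*} [NormedAddCommGroup E] [InnerProductSpace ℝ E]
    [FiniteDimensional ℝ E] (ℓ : E →ₗ[ℝ] Poly n) :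
    Continuous fun p : E × EuclideanSpace ℝ (Fin n) => val (ℓ p.1) p.2 := by
  let b := Module.finBasis ℝ E
  have h : ∀ p : E × EuclideanSpace ℝ (Fin n),
      val (ℓ p.1) p.2 = ∑ i, b.coord i p.1 * val (ℓ (b i)) p.2 := by
    intro p
    have hp : ℓ p.1 = ∑ i, b.coord i p.1 • ℓ (b i) := by
      conv_lhs => rw [← b.sum_repr p.1, map_sum]
      simp
    rw [hp]
    simp [val]
  simp only [h]
  refine continuous_finsetSum _ fun i _ => Continuous.mul ?_ ((continuous_val _).comp
    continuous_snd)
  exact (b.coord i).continuous_of_finiteDimensional.comp continuous_fst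

lemma continuous_uncurry_vecVal {E : Type*} [NormedAddCommGroup E] [InnerProductSpace ℝ E]
    [FiniteDimensional ℝ E] (ι : E →ₗ[ℝ] Fin n → Poly n) :
    Continuous fun p : E × EuclideanSpace ℝ (Fin n) => vecVal (ι p.1) p.2 :=
  (PiLp.continuous_toLp 2 _).comp
    (continuous_pi fun j => continuous_uncurry_val (LinearMap.proj j ∘ₗ ι))

/-- `u ↦ c_{h,K}(u; u, v)` is continuous on finite-dimensional spaces. -/
lemma continuous_cK {r : ℝ} (hr : 2 ≤ r) (α : ℝ) {E : Type*} [NormedAddCommGroup E]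
    [InnerProductSpace ℝ E] [FiniteDimensional ℝ E] (ι : E →ₗ[ℝ] Fin n → Poly n)
    (v : Fin n → Poly n) : Continuous fun y => cK K α r (ι y) (ι y) v := by
  refine continuous_parametric_integral_of_continuous ?_ (isCompact_element K)
  have h := continuous_uncurry_vecVal ι
  exact (continuous_const.mul (h.norm.rpow_const fun _ => Or.inr (by linarith))).mul
    (h.inner ((continuous_vecVal v).comp continuous_snd))

lemma integrable_inner_vecVal {f : EuclideanSpace ℝ (Fin n) → EuclideanSpace ℝ (Fin n)}
    (hf : MemLp f 2 (volume.restrict K.closedInterior)) (v : Fin n → Poly n) :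
    IntegrableOn (fun x => inner ℝ (f x) (vecVal v x)) K.closedInterior := by
  have : IsFiniteMeasure (volume.restrict K.closedInterior) :=
    ⟨by rw [Measure.restrict_apply_univ]; exact (isCompact_element K).measure_lt_top⟩
  obtain ⟨C, hC⟩ := (isCompact_element K).exists_bound_of_continuousOn
    (continuous_vecVal v).continuousOn
  refine ((hf.integrable one_le_two).norm.mul_const C).mono'
    (hf.1.inner (continuous_vecVal v).aestronglyMeasurable) ?_
  refine (ae_restrict_iff' (isCompact_element K).measurableSet).2 (.of_forall fun x hx => ?_)
  exact (norm_inner_le_norm _ _).trans (by gcongr; exact hC x hx)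

variable [NeZero n]

/-- The functional `F_{h,K}`. -/
def FForm (m k : ℕ) (ν : ℝ) {f : EuclideanSpace ℝ (Fin n) → EuclideanSpace ℝ (Fin n)}
    (hf : MemLp f 2 (volume.restrict K.closedInterior))
    (ub : Fin (n + 1) → Fin n → Poly n) (pb : Fin (n + 1) → Poly n) :
    (Fin n → Poly n) →ₗ[ℝ] ℝ where
  toFun := FK K m k ν f ub pb
  map_add' v w := by
    simp only [FK, vecVal_add, inner_add_right, vecWeakGrad_add, matInnerK_add_right,
      vecInnerK_add_right, Pi.add_apply, faceProj_add, mul_add, Finset.sum_add_distrib]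
    rw [integral_add (integrable_inner_vecVal K hf v) (integrable_inner_vecVal K hf w)]
    ring
  map_smul' c v := by
    simp only [FK, vecVal_smul, real_inner_smul_right, vecWeakGrad_smul, matInnerK_smul_right,
      vecInnerK_smul_right, Pi.smul_apply, faceProj_smul, integral_const_mul, RingHom.id_apply,
      smul_eq_mul, mul_left_comm _ c, ← Finset.mul_sum]
    ring

end Forms

/-! ### The energy norm -/

section Norm

variable {n : ℕ}

lemma pderiv_mem_P {m : ℕ} {p : Poly n} (hp : p ∈ P n m) (j : Fin n) :
    MvPolynomial.pderiv j p ∈ P n (m - 1) := by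
  rw [MvPolynomial.mem_restrictTotalDegree] at hp ⊢
  refine Finset.sup_le fun s hs => ?_
  rw [MvPolynomial.mem_support_iff, MvPolynomial.coeff_pderiv] at hs
  have h := MvPolynomial.le_totalDegree
    (MvPolynomial.mem_support_iff.2 (left_ne_zero_of_mul hs))
  rw [Finsupp.sum_add_index' (fun _ => rfl) (fun _ _ _ => rfl),
    Finsupp.sum_single_index rfl] at h
  omega

lemma eq_C_of_pderiv_eq_zero {p : Poly n} (hp : ∀ j, MvPolynomial.pderiv j p = 0) :
    p = MvPolynomial.C (val p 0) := by
  refine MvPolynomial.funext fun x => ?_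
  have h := is_const_of_deriv_eq_zero
    (fun s => (hasDerivAt_val p 0 (WithLp.toLp 2 x) s).differentiableAt)
    (fun s => by rw [(hasDerivAt_val p 0 (WithLp.toLp 2 x) s).deriv]; simp [hp, val]) 1 0
  simpa [val] using h

variable [NeZero n] (K : Element n)

lemma innerFace_eq_zero_of_faceProj {k : ℕ} {i : Fin (n + 1)} {p : Poly n}
    (h : faceProj K k i p = 0) {q : Poly n} (hq : q ∈ P n k) : innerFace K i p q = 0 := by
  have h1 := (Submodule.starProjection_apply_eq_zero_iff _).1 h
  have h2 := (Submodule.mem_orthogonal _ _).1 h1 (trace K i q) ⟨q, hq, rfl⟩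
  rw [L2.inner_def] at h2
  rw [← h2, innerFace]
  refine integral_congr_ae ?_
  have hm : ∀ p : Poly n, MemLp (val p) 2 (faceMeasure K i) := fun p =>
    (memLp_two_iff_integrable_sq (continuous_val p).aestronglyMeasurable).2
      (by simpa only [sq] using integrable_face K i p p)
  have hp' : trace K i p =ᵐ[faceMeasure K i] val p := (hm p).coeFn_toLp
  have hq' : trace K i q =ᵐ[faceMeasure K i] val q := (hm q).coeFn_toLp
  filter_upwards [hp', hq'] with x h3 h4
  simp [h3, h4]

/-- A polynomial of degree at most `m` which is orthogonal to `P_{m-2}(K)`, here through its weak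
gradient, and to `P_{m-1}` on the faces, vanishes: integration by parts gives `∇p = 0`, so `p` is
constant, and has mean value `0` on the faces. -/
lemma eq_zero_of_weakGrad_eq_zero {m k : ℕ} (hk : m - 1 ≤ k) {p : Poly n}
    (hp : p ∈ P n m) (hw : weakGrad K (m - 1) p 0 = 0) (hb : ∀ i, faceProj K k i p = 0) :
    p = 0 := by
  have hgrad : ∀ j, MvPolynomial.pderiv j p = 0 := by
    intro j
    set q := MvPolynomial.pderiv j p with hq
    have hqm : q ∈ P n (m - 1) := pderiv_mem_P hp j
    have hqk : q ∈ P n k := by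
      rw [MvPolynomial.mem_restrictTotalDegree] at hqm ⊢
      exact hqm.trans hk
    have h1 : innerK K p (MvPolynomial.pderiv j q) = 0 := by
      have h := sum_innerK_weakGrad K (γ := m - 1) p (ς := Pi.single j q) (by
        intro l _
        rcases eq_or_ne l j with rfl | hl
        · simpa using hqm
        · simp [hl])
      have hdiv : div (Pi.single j q : Fin n → Poly n) = MvPolynomial.pderiv j q := by
        rw [div, Finset.sum_eq_single j (fun l _ hl => by simp [hl]) (by simp)]
        simp
      rw [hw, hdiv] at h
      have h0 : vecInnerK K 0 (Pi.single j q : Fin n → Poly n) = 0 := by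
        simp [vecInnerK, innerK, val]
      linarith
    have h2 := integral_pderiv_eq_zero K (p * q) (fun i => by
      simpa [innerFace, val] using innerFace_eq_zero_of_faceProj K (hb i) hqk) j
    have h3 : ∀ x, val (MvPolynomial.pderiv j (p * q)) x
        = val p x * val (MvPolynomial.pderiv j q) x + val q x * val q x := by
      intro x
      simp [val, hq]
    simp only [h3] at h2
    rw [integral_add (integrable_K K _ _) (integrable_K K _ _)] at h2
    have h4 : innerK K p (MvPolynomial.pderiv j q) + innerK K q q = 0 := h2
    exact eq_zero_of_innerK_self K q (by linarith)
  rw [eq_C_of_pderiv_eq_zero hgrad] at hb ⊢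
  set c := val p 0
  by_contra hc
  have hc' : c ≠ 0 := fun h => hc (by simp [h])
  -- Otherwise the faces would be null sets, and Green's formula for `x₀` would fail.
  have hone : (1 : Poly n) ∈ P n k := by simp [MvPolynomial.mem_restrictTotalDegree]
  have hface : ∀ i, faceMeasure K i = 0 := by
    intro i
    have h := innerFace_eq_zero_of_faceProj K (hb i) hone
    simpa [innerFace, val, hc', measureReal_eq_zero_iff] using h
  have h5 := integral_pderiv_eq_zero K (MvPolynomial.X 0) (fun i => by simp [hface]) 0
  have h6 : innerK K 1 1 = 0 := by simpa [innerK, val] using h5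
  exact one_ne_zero (eq_zero_of_innerK_self K 1 h6)

lemma hK_pos : 0 < hK K := by
  have hb := (isCompact_element K).isBounded
  have h0 := K.point_mem_closedInterior 0
  have h1 := K.point_mem_closedInterior (Fin.last n)
  have hne : K.points 0 ≠ K.points (Fin.last n) := fun h => by
    have := congrArg Fin.val (K.independent.injective h)
    simp [eq_comm, NeZero.ne n] at this
  exact (dist_pos.2 hne).trans_le (Metric.dist_le_diam_of_mem hb h0 h1)

lemma stab_self (k : ℕ) (v : Fin n → Poly n) :
    stab K k v v = ∑ i, ∑ j, (hK K)⁻¹ * ‖faceProj K k i (v j)‖ ^ 2 := by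
  simp only [stab, real_inner_self_eq_norm_sq]

lemma stab_self_nonneg (k : ℕ) (v : Fin n → Poly n) : 0 ≤ stab K k v v := by
  rw [stab_self]
  have := (hK_pos K).le
  positivity

lemma normVK_sq (m k : ℕ) (v : Fin n → Poly n) :
    normVK K m k v ^ 2 = matInnerK K (vecWeakGrad K (m - 1) v 0) (vecWeakGrad K (m - 1) v 0)
      + stab K k v v :=
  Real.sq_sqrt (add_nonneg (matInnerK_self_nonneg K _) (stab_self_nonneg K k v))

lemma aK_self (m k : ℕ) (ν : ℝ) (v : Fin n → Poly n) :
    aK K m k ν v v = ν * normVK K m k v ^ 2 := by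
  rw [normVK_sq, aK]
  ring

lemma normVK_pos {m k : ℕ} (hk : m - 1 ≤ k) {v : Fin n → Poly n} (hv : v ∈ VecP n m)
    (h0 : v ≠ 0) : 0 < normVK K m k v := by
  refine (Real.sqrt_nonneg _).lt_of_ne' fun h => h0 ?_
  have hsq := normVK_sq K m k v
  rw [show normVK K m k v = 0 from h] at hsq
  have hm := matInnerK_self_nonneg K (vecWeakGrad K (m - 1) v 0)
  have hs := stab_self_nonneg K k v
  have hg : vecWeakGrad K (m - 1) v 0 = 0 := eq_zero_of_matInnerK_self K _ (by linarith)
  have hs0 : stab K k v v = 0 := by linarith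
  have hh := inv_pos.2 (hK_pos K)
  rw [stab_self] at hs0
  have hf : ∀ i j, faceProj K k i (v j) = 0 := by
    intro i j
    have h1 := (Finset.sum_eq_zero_iff_of_nonneg fun i _ =>
      Finset.sum_nonneg fun j _ => by positivity).1 hs0 i (Finset.mem_univ i)
    have h2 := (Finset.sum_eq_zero_iff_of_nonneg fun j _ => by positivity).1 h1 j
      (Finset.mem_univ j)
    simpa [hh.ne', (hK_pos K).ne'] using h2
  funext j
  exact eq_zero_of_weakGrad_eq_zero K hk (hv j (Set.mem_univ j)) (congrFun hg j) fun i => hf i j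

end Norm

/-! ### The pressure -/

section Pressure

variable {n : ℕ}

lemma exists_pderiv_eq [NeZero n] {m : ℕ} (hm : 1 ≤ m) {q : Poly n} (hq : q ∈ P n (m - 1)) :
    ∃ w ∈ P n m, MvPolynomial.pderiv 0 w = q := by
  rw [MvPolynomial.mem_restrictTotalDegree] at hq
  refine ⟨∑ s ∈ q.support, MvPolynomial.monomial (s + Finsupp.single 0 1)
    (MvPolynomial.coeff s q / (s 0 + 1)), Submodule.sum_mem _ fun s hs => ?_, ?_⟩
  · rw [MvPolynomial.mem_restrictTotalDegree]
    refine (MvPolynomial.totalDegree_monomial_le _ _).trans ?_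
    have h := MvPolynomial.le_totalDegree hs
    rw [Finsupp.sum_add_index' (fun _ => rfl) (fun _ _ _ => rfl),
      Finsupp.sum_single_index rfl]
    change (s.sum fun _ e => e) + 1 ≤ m
    omega
  · rw [map_sum]
    conv_rhs => rw [q.as_sum]
    refine Finset.sum_congr rfl fun s _ => ?_
    rw [MvPolynomial.pderiv_monomial, add_tsub_cancel_right]
    congr 1
    have : (s 0 : ℝ) + 1 ≠ 0 := by positivity
    simp only [Finsupp.add_apply, Finsupp.single_eq_same, Nat.cast_add, Nat.cast_one]
    field_simp

lemma exists_div_eq [NeZero n] {m : ℕ} (hm : 1 ≤ m) {q : Poly n} (hq : q ∈ P n (m - 1)) :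
    ∃ v ∈ VecP n m, div v = q := by
  obtain ⟨w, hw, h⟩ := exists_pderiv_eq hm hq
  refine ⟨Pi.single 0 w, fun j _ => ?_, ?_⟩
  · rcases eq_or_ne j 0 with rfl | hj
    · simpa using hw
    · simp [hj]
  · rw [div, Finset.sum_eq_single 0 (fun l _ hl => by simp [hl]) (by simp)]
    simpa using h

variable [NeZero n] (K : Element n)

/-- The pressure is determined by the velocity, as `∇· : [P_m]ⁿ → P_{m-1}` is onto. -/
lemma pressure_unique {m : ℕ} (hm : 1 ≤ m) {p q : Poly n} (hp : p ∈ P n (m - 1))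
    (hq : q ∈ P n (m - 1)) (h : ∀ v ∈ VecP n m, bK K m v p = bK K m v q) : p = q := by
  obtain ⟨v, hv, hdiv⟩ := exists_div_eq hm (sub_mem hp hq)
  have h1 := h v hv
  rw [bK_eq K hv, bK_eq K hv, hdiv] at h1
  have h2 := innerK_sub_left K p q (p - q)
  exact sub_eq_zero.1 (eq_zero_of_innerK_self K _ (by linarith))

/-- A functional vanishing on `V_{0h,K}` is of the form `b_{h,K}(·, p)`. -/
lemma exists_pressure {m : ℕ} (L : (Fin n → Poly n) →ₗ[ℝ] ℝ) (hL : ∀ v ∈ V0K K m, L v = 0) :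
    ∃ p ∈ P n (m - 1), ∀ v ∈ VecP n m, bK K m v p = L v := by
  let B : VecP n m →ₗ[ℝ] P n (m - 1) →ₗ[ℝ] ℝ :=
    (bForm K).compl₁₂ (VecP n m).subtype (P n (m - 1)).subtype
  have hB : ∀ (v : VecP n m) (q : P n (m - 1)), B v q = bK K m v q := fun v q =>
    (bK_eq K v.2 q).symm
  have hmem : L ∘ₗ (VecP n m).subtype ∈ (LinearMap.ker B).dualAnnihilator := by
    rw [Submodule.mem_dualAnnihilator]
    intro v hv
    refine hL v ⟨v.2, fun q hq => ?_⟩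
    rw [← hB v ⟨q, hq⟩, LinearMap.mem_ker.1 hv, LinearMap.zero_apply]
  rw [LinearMap.dualAnnihilator_ker_eq_range_flip] at hmem
  obtain ⟨p, hp⟩ := hmem
  refine ⟨p, p.2, fun v hv => ?_⟩
  rw [← hB ⟨v, hv⟩, ← LinearMap.flip_apply, hp]
  rfl

end Pressure

/-! ### Existence and uniqueness -/

section Main

variable {n : ℕ} [NeZero n] (K : Element n)

/-- `V_{0h,K}` as a subspace. -/
def V0Submodule (m : ℕ) : Submodule ℝ (Fin n → Poly n) where
  carrier := V0K K m
  zero_mem' := ⟨zero_mem _, fun q _ => by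
    rw [bK_eq K (zero_mem _)]
    simp [div, innerK_zero_right]⟩
  add_mem' := by
    rintro u v ⟨hu, hu'⟩ ⟨hv, hv'⟩
    refine ⟨add_mem hu hv, fun q hq => ?_⟩
    have h1 := hu' q hq
    have h2 := hv' q hq
    rw [bK_eq K hu] at h1
    rw [bK_eq K hv] at h2
    rw [bK_eq K (add_mem hu hv), div_add, innerK_add_right]
    linarith
  smul_mem' := by
    rintro c v ⟨hv, hv'⟩
    refine ⟨Submodule.smul_mem _ c hv, fun q hq => ?_⟩
    have h1 := hv' q hq
    rw [bK_eq K hv] at h1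
    rw [bK_eq K (Submodule.smul_mem _ c hv), div_smul, innerK_smul_right, neg_eq_zero.1 h1]
    simp

instance finiteDimensional_VecP (m : ℕ) : FiniteDimensional ℝ (VecP n m) := by
  let φ : VecP n m →ₗ[ℝ] (Fin n → P n m) :=
    LinearMap.pi fun j => LinearMap.codRestrict (P n m)
      (LinearMap.proj j ∘ₗ (VecP n m).subtype) fun v => v.2 j (Set.mem_univ j)
  refine FiniteDimensional.of_injective φ fun u v h => ?_
  ext1
  funext j
  exact congrArg Subtype.val (congrFun h j)

/-- Linear coordinates on `V_{0h,K}`, in a Euclidean space. -/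
lemma exists_coordinates (m : ℕ) :
    ∃ (d : ℕ) (ι : EuclideanSpace ℝ (Fin d) →ₗ[ℝ] (Fin n → Poly n)),
      Function.Injective ι ∧ Set.range ι = V0K K m := by
  have hle : V0Submodule K m ≤ VecP n m := fun v hv => hv.1
  have : FiniteDimensional ℝ (V0Submodule K m) := Submodule.finiteDimensional_of_le hle
  let e : EuclideanSpace ℝ (Fin (Module.finrank ℝ (V0Submodule K m))) ≃ₗ[ℝ] V0Submodule K m :=
    LinearEquiv.ofFinrankEq _ _ (by simp)
  refine ⟨_, (V0Submodule K m).subtype ∘ₗ e.toLinearMap,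
    Subtype.val_injective.comp e.injective, ?_⟩
  have : Set.range (⇑((V0Submodule K m).subtype ∘ₗ e.toLinearMap))
      = Subtype.val '' Set.range e := by
    rw [← Set.range_comp]
    rfl
  rw [this, e.surjective.range_eq, Set.image_univ, Subtype.range_coe]
  rfl

section Bounds

variable {m k : ℕ} {E : Type*} [NormedAddCommGroup E] [InnerProductSpace ℝ E]
  [FiniteDimensional ℝ E] {ι : E →ₗ[ℝ] (Fin n → Poly n)}

lemma mul_norm_le_normVK (hk : m - 1 ≤ k) (hinj : Function.Injective ι)
    (hι : ∀ x, ι x ∈ VecP n m) : ∃ δ > 0, ∀ x, δ * ‖x‖ ≤ normVK K m k (ι x) := by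
  obtain ⟨δ, hδ, h⟩ := exists_pos_mul_norm_sq_le ((aForm K m k 1).compl₁₂ ι ι) (fun x hx => by
    have : 0 < normVK K m k (ι x) := normVK_pos K hk (hι x)
      fun h => hx (hinj (h.trans (map_zero ι).symm))
    change 0 < aK K m k 1 (ι x) (ι x)
    rw [aK_self]
    positivity)
  refine ⟨Real.sqrt δ, Real.sqrt_pos.2 hδ, fun x => ?_⟩
  refine abs_le_of_sq_le_sq' ?_ (Real.sqrt_nonneg _) |>.2
  have h1 : δ * ‖x‖ ^ 2 ≤ aK K m k 1 (ι x) (ι x) := h x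
  rw [aK_self, one_mul] at h1
  rwa [mul_pow, Real.sq_sqrt hδ.le]

end Bounds

lemma bddAbove_quotientsN {m k : ℕ} (hk : m - 1 ≤ k) : BddAbove (quotientsN K m k) := by
  obtain ⟨d, ι, hinj, hrange⟩ := exists_coordinates K m
  have hι : ∀ x, ι x ∈ V0K K m := fun x => hrange ▸ Set.mem_range_self x
  obtain ⟨δ, hδ, hlow⟩ := mul_norm_le_normVK K hk hinj fun x => (hι x).1
  obtain ⟨M, hM, hbd⟩ := exists_abs_le_mul_norm_mul_norm_mul_norm
    (((dForm K).compl₁₂ ι ι).compr₂ (LinearMap.lcomp ℝ ℝ ι))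
  refine ⟨M / δ ^ 3, ?_⟩
  rintro _ ⟨κ, hκ, u, hu, v, hv, hκ0, hu0, hv0, rfl⟩
  have hpos : 0 < normVK K m k κ * normVK K m k u * normVK K m k v :=
    mul_pos (mul_pos (normVK_pos K hk hκ.1 hκ0) (normVK_pos K hk hu.1 hu0))
      (normVK_pos K hk hv.1 hv0)
  rw [← hrange] at hκ hu hv
  obtain ⟨z, rfl⟩ := hκ
  obtain ⟨x, rfl⟩ := hu
  obtain ⟨y, rfl⟩ := hv
  have hn : ∀ v, 0 ≤ normVK K m k v := fun v => Real.sqrt_nonneg _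
  have hnz := hn (ι z)
  have hnx := hn (ι x)
  rw [dK_eq K _ (hι x).1 (hι y).1, div_le_div_iff₀ hpos (by positivity)]
  calc dForm K (ι z) (ι x) (ι y) * δ ^ 3
      ≤ M * (‖z‖ * ‖x‖ * ‖y‖) * δ ^ 3 := by
        gcongr
        exact le_of_abs_le (hbd z x y)
    _ = M * (δ * ‖z‖ * (δ * ‖x‖) * (δ * ‖y‖)) := by ring
    _ ≤ _ := by
        gcongr
        · exact hlow z
        · exact hlow x
        · exact hlow y

lemma bddAbove_quotientsF {m k : ℕ} (hk : m - 1 ≤ k) (ν : ℝ)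
    {f : EuclideanSpace ℝ (Fin n) → EuclideanSpace ℝ (Fin n)}
    (hf : MemLp f 2 (volume.restrict K.closedInterior))
    (ub : Fin (n + 1) → Fin n → Poly n) (pb : Fin (n + 1) → Poly n) :
    BddAbove (quotientsF K m k ν f ub pb) := by
  obtain ⟨d, ι, hinj, hrange⟩ := exists_coordinates K m
  have hι : ∀ x, ι x ∈ V0K K m := fun x => hrange ▸ Set.mem_range_self x
  obtain ⟨δ, hδ, hlow⟩ := mul_norm_le_normVK K hk hinj fun x => (hι x).1
  obtain ⟨M, hM, hbd⟩ := exists_abs_le_mul_norm (FForm K m k ν hf ub pb ∘ₗ ι)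
  refine ⟨M / δ, ?_⟩
  rintro _ ⟨v, hv, hv0, rfl⟩
  have hpos := normVK_pos K hk hv.1 hv0
  rw [← hrange] at hv
  obtain ⟨y, rfl⟩ := hv
  rw [div_le_div_iff₀ hpos hδ]
  calc FK K m k ν f ub pb (ι y) * δ ≤ M * ‖y‖ * δ := by
        gcongr
        exact le_of_abs_le (hbd y)
    _ = M * (δ * ‖y‖) := by ring
    _ ≤ _ := by
        gcongr
        exact hlow y

lemma exists_isLocalSolution {m k : ℕ} (hk : m - 1 ≤ k) {ν α r : ℝ} (hν : 0 < ν) (hα : 0 ≤ α)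
    (hr : 2 ≤ r) {f : EuclideanSpace ℝ (Fin n) → EuclideanSpace ℝ (Fin n)}
    (hf : MemLp f 2 (volume.restrict K.closedInterior))
    (ub : Fin (n + 1) → Fin n → Poly n) (pb : Fin (n + 1) → Poly n) :
    ∃ u p, IsLocalSolution K m k ν α r f ub pb u p := by
  obtain ⟨d, ι, hinj, hrange⟩ := exists_coordinates K m
  have hι : ∀ x, ι x ∈ V0K K m := fun x => hrange ▸ Set.mem_range_self x
  obtain ⟨x, hx⟩ := exists_variational_solution ((aForm K m k ν).compl₁₂ ι ι)
    (fun x hx => by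
      have : 0 < normVK K m k (ι x) := normVK_pos K hk (hι x).1
        fun h => hx (hinj (h.trans (map_zero ι).symm))
      change 0 < aK K m k ν (ι x) (ι x)
      rw [aK_self]
      positivity)
    (fun x => cForm K hr α (ι x) (ι x) ∘ₗ ι)
    (fun y => continuous_cK K hr α ι (ι y))
    (fun x => cK_self_nonneg K hα r (ι x))
    (((dForm K).compl₁₂ ι ι).compr₂ (LinearMap.lcomp ℝ ℝ ι))
    (fun x y => dForm_self K (ι x) (ι y))
    (FForm K m k ν hf ub pb ∘ₗ ι)
  set u := ι x with hu
  let L : (Fin n → Poly n) →ₗ[ℝ] ℝ := FForm K m k ν hf ub pb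
    - (aForm K m k ν u + cForm K hr α u u + dForm K u u)
  have hL : ∀ v, L v = FK K m k ν f ub pb v
      - (aK K m k ν u v + cK K α r u u v + dForm K u u v) := fun v => rfl
  obtain ⟨p, hp, hpv⟩ := exists_pressure K L (m := m) (by
    intro v hv
    rw [← hrange] at hv
    obtain ⟨y, rfl⟩ := hv
    have h : aK K m k ν u (ι y) + cK K α r u u (ι y) + dForm K u u (ι y)
        = FK K m k ν f ub pb (ι y) := hx y
    rw [hL, h, sub_self])
  refine ⟨u, p, (hι x).1, hp, fun v hv => ?_, (hι x).2⟩
  rw [hpv v hv, hL, dK_eq K u (hι x).1 hv]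
  ring

/-- Energy estimate for the velocity. -/
lemma nu_mul_normVK_le {m k : ℕ} (hk : m - 1 ≤ k) {ν α r : ℝ} (hα : 0 ≤ α)
    {f : EuclideanSpace ℝ (Fin n) → EuclideanSpace ℝ (Fin n)}
    (hf : MemLp f 2 (volume.restrict K.closedInterior))
    {ub : Fin (n + 1) → Fin n → Poly n} {pb : Fin (n + 1) → Poly n} {u : Fin n → Poly n}
    {p : Poly n} (h : IsLocalSolution K m k ν α r f ub pb u p) (hu0 : u ≠ 0) :
    ν * normVK K m k u ≤ normFK K m k ν f ub pb := by
  obtain ⟨hu, hp, hmom, hdiv⟩ := h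
  have hpos := normVK_pos K hk hu hu0
  have h1 := hmom u hu
  rw [hdiv p hp, dK_eq K u hu hu, dForm_self, aK_self] at h1
  have h2 := cK_self_nonneg K hα r u
  have h3 : FK K m k ν f ub pb u / normVK K m k u ≤ normFK K m k ν f ub pb :=
    le_csSup (bddAbove_quotientsF K hk ν hf ub pb) ⟨u, ⟨hu, hdiv⟩, hu0, rfl⟩
  refine le_trans ?_ h3
  rw [le_div_iff₀ hpos]
  nlinarith

/-- Two solutions have the same velocity under the smallness condition: testing the difference of
the equations with the difference `w` of the velocities leaves `ν |||w|||² ≤ d(w; w, u)`, by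
monotonicity of `c` and skew-symmetry of `d`. -/
lemma velocity_unique {m k : ℕ} (hk : m - 1 ≤ k) {ν α r : ℝ} (hν : 0 < ν) (hα : 0 ≤ α)
    (hr : 2 ≤ r) {f : EuclideanSpace ℝ (Fin n) → EuclideanSpace ℝ (Fin n)}
    (hf : MemLp f 2 (volume.restrict K.closedInterior))
    {ub : Fin (n + 1) → Fin n → Poly n} {pb : Fin (n + 1) → Poly n} {u u' : Fin n → Poly n}
    {p p' : Poly n} (h : IsLocalSolution K m k ν α r f ub pb u p)
    (h' : IsLocalSolution K m k ν α r f ub pb u' p')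
    (hsmall : NK K m k * normFK K m k ν f ub pb / ν ^ 2 < 1) : u = u' := by
  by_contra hne
  set w := u - u' with hw
  have hw0 : w ≠ 0 := sub_ne_zero.2 hne
  have hu0 : u ∈ V0K K m := ⟨h.1, h.2.2.2⟩
  have hw' : w ∈ V0K K m := (V0Submodule K m).sub_mem hu0
    (show u' ∈ V0K K m from ⟨h'.1, h'.2.2.2⟩)
  have hpos := normVK_pos K hk hw'.1 hw0
  have hwp := mul_pos hν (pow_pos hpos 2)
  have e1 := h.2.2.1 w hw'.1
  have e2 := h'.2.2.1 w hw'.1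
  rw [hw'.2 p h.2.1, dK_eq K _ h.1 hw'.1] at e1
  rw [hw'.2 p' h'.2.1, dK_eq K _ h'.1 hw'.1] at e2
  have hc := cK_sub_nonneg K hr hα u u'
  rw [← hw] at hc
  have ha : aK K m k ν u w - aK K m k ν u' w = ν * normVK K m k w ^ 2 := by
    rw [← aK_self]
    change aForm K m k ν u w - aForm K m k ν u' w = aForm K m k ν w w
    rw [hw, map_sub (aForm K m k ν), LinearMap.sub_apply]
  have hd : dForm K u u w - dForm K u' u' w = -dForm K w w u := by
    have hskew := dForm_self K w (w + u)
    have h0 := dForm_self K u' w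
    simp only [map_add, LinearMap.add_apply, dForm_self] at hskew
    have hu' : dForm K u' u w = dForm K u' u' w := by
      have : u = u' + w := by simp [hw]
      conv_lhs => rw [this, map_add, LinearMap.add_apply, h0, add_zero]
    have hsub : dForm K w u w = dForm K u u w - dForm K u' u w := by
      have hlin : dForm K w = dForm K u - dForm K u' := by rw [hw, map_sub]
      rw [hlin, LinearMap.sub_apply, LinearMap.sub_apply]
    linarith
  have hmain : ν * normVK K m k w ^ 2 ≤ dK K m w w u := by
    rw [dK_eq K w hw'.1 h.1]
    linarith
  have hune : u ≠ 0 := by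
    rintro rfl
    rw [dK_eq K w hw'.1 h.1, map_zero] at hmain
    linarith
  have hupos := normVK_pos K hk h.1 hune
  have hN : dK K m w w u / (normVK K m k w * normVK K m k w * normVK K m k u) ≤ NK K m k :=
    le_csSup (bddAbove_quotientsN K hk) ⟨w, hw', w, hw', u, hu0, hw0, hw0, hune, rfl⟩
  have hden : 0 < normVK K m k w * normVK K m k w * normVK K m k u := by positivity
  have hNpos : 0 < NK K m k := lt_of_lt_of_le (div_pos (hwp.trans_le hmain) hden) hN
  rw [div_le_iff₀ hden] at hN
  have hF := nu_mul_normVK_le K hk hα hf h hune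
  rw [div_lt_one (by positivity)] at hsmall
  -- `ν ≤ 𝒩 |||u|||` and `ν |||u||| ≤ ‖F‖` contradict the smallness condition.
  have h1 : ν ≤ NK K m k * normVK K m k u := by
    refine le_of_mul_le_mul_right ?_ (pow_pos hpos 2)
    linarith
  nlinarith [mul_le_mul_of_nonneg_left hF hNpos.le, mul_le_mul_of_nonneg_left h1 hν.le]

end Main

end

end WG

theorem theorem6p1 (n : ℕ) [NeZero n] (hn : n = 2 ∨ n = 3)
    (m k : ℕ) (hm : 1 ≤ m) (hk : k = m - 1 ∨ k = m)
    (ν α r : ℝ) (hν : 0 < ν) (hα : 0 < α) (hr : 2 ≤ r)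
    (K : WG.Element n)
    (f : EuclideanSpace ℝ (Fin n) → EuclideanSpace ℝ (Fin n))
    (hf : MeasureTheory.MemLp f 2 (MeasureTheory.volume.restrict K.closedInterior))
    (ub : Fin (n + 1) → Fin n → WG.Poly n) (hub : ∀ i, ub i ∈ WG.VecP n k)
    (pb : Fin (n + 1) → WG.Poly n) (hpb : ∀ i, pb i ∈ WG.P n m) :
    (∃ u p, WG.IsLocalSolution K m k ν α r f ub pb u p) ∧
    BddAbove (WG.quotientsN K m k) ∧
    BddAbove (WG.quotientsF K m k ν f ub pb) ∧
    (WG.NK K m k * WG.normFK K m k ν f ub pb / ν ^ 2 < 1 →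
      ∃! up : (Fin n → WG.Poly n) × WG.Poly n,
        WG.IsLocalSolution K m k ν α r f ub pb up.1 up.2) := by
  have hk' : m - 1 ≤ k := by omega
  obtain ⟨u, p, h⟩ := WG.exists_isLocalSolution K hk' hν hα.le hr hf ub pb
  refine ⟨⟨u, p, h⟩, WG.bddAbove_quotientsN K hk', WG.bddAbove_quotientsF K hk' ν hf ub pb,
    fun hsmall => ⟨(u, p), h, ?_⟩⟩
  rintro ⟨u', p'⟩ (h' : WG.IsLocalSolution K m k ν α r f ub pb u' p')
  obtain rfl := WG.velocity_unique K hk' hν hα.le hr hf h h' hsmall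
  have hp : p' = p := WG.pressure_unique K hm h'.2.1 h.2.1 fun v hv => by
    linarith [h.2.2.1 v hv, h'.2.2.1 v hv]
  rw [hp]
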